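/- Let $\Omega\subset\mathbb{R}^3$ be open, bounded and convex with Lebesgue measure $\mathcal{L}^3(\Omega)=1$, let $N\ge 2$ be an integer and let $T\in(0,\infty)$. Let $m_1,\dots,m_N>0$ with $\sum_i m_i=1$, and let $\overline z_1,\dots,\overline z_N\in\mathbb{R}^3$ be pairwise distinct. Assume that $\overline\alpha=\sum_{i=1}^N m_i\delta_{\overline z_i}$ is well-prepared: there is $r>0$ with $|(\overline z_i-\overline z_j)\cdot e_3|\ge r$ for all $i\ne j$. Notation. $\mathcal{P}_c(\mathbb{R}^3)$ is the set of compactly supported Borel probability measures on $\mathbb{R}^3$, equipped with the Wasserstein 2-distance. For $\nu\in\mathcal{P}_c(\mathbb{R}^3)$, $\mathcal{B}[\nu]$ is the unique mean-zero convex function in $H^1(\Omega)$ whose gradient is the optimal transport map from $\mathcal{L}^3|_\Omega$ to $\nu$ for the cost $|x-y|^2$. $J$ is the linear map $J(z_1,z_2,z_3)=(-z_2,z_1,0)$ of $\mathbb{R}^3$. The geostrophic energy is $$E[\nu]=\int_\Omega\Big(\tfrac12\big((\partial_1\mathcal{B}[\nu](x)-x_1)^2+(\partial_2\mathcal{B}[\nu](x)-x_2)^2\big)-x_3\,\partial_3\mathcal{B}[\nu](x)\Big)\,dx.$$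 A geostrophic solution on $[0,T]$ with initial measure $\overline\alpha$ is a map $\alpha\in C([0,T];\mathcal{P}_c(\mathbb{R}^3))$ such that, for all $\varphi\in C_c^\infty(\mathbb{R}^3\times\mathbb{R})$, $$\int_0^T\!\!\int_{\mathbb{R}^3}\big(\partial_t\varphi(z,t)+Jz\cdot\nabla\varphi(z,t)\big)\,d\alpha_t(z)\,dt-\int_0^T\!\!\int_\Omega Jx\cdot\nabla\varphi\big(\nabla\mathcal{B}[\alpha_t](x),t\big)\,dx\,dt=\int_{\mathbb{R}^3}\varphi(z,T)\,d\alpha_T(z)-\int_{\mathbb{R}^3}\varphi(z,0)\,d\overline\alpha(z).$$ It is a continuously differentiable discrete geostrophic solution if, in addition, there are $N'\in\mathbb{N}$, constants $m'_1,\dots,m'_{N'}>0$ with $\sum_i m'_i=1$ and a continuously differentiable map $(z_1,\dots,z_{N'}):[0,T]\to(\mathbb{R}^3)^{N'}$ such that, for every $t\in[0,T]$, the points $z_i(t)$ are pairwise distinct and $\alpha_t=\sum_{i=1}^{N'}m'_i\delta_{z_i(t)}$. Claim. There exists a unique continuously differentiable discrete geostrophic solution $\alpha$ on $[0,T]$ with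 initial measure $\overline\alpha$. It is energy-conserving, i.e. $t\mapsto E[\alpha_t]$ is constant on $[0,T]$. It has the form $\alpha_t=\sum_{i=1}^N m_i\delta_{z_i(t)}$ with the given masses $m_i$ and continuously differentiable paths $z_i:[0,T]\to\mathbb{R}^3$ with $z_i(0)=\overline z_i$ and pairwise distinct $z_1(t),\dots,z_N(t)$ for each $t\in[0,T]$. -/

import Mathlib

open MeasureTheory Set Filter Topology
open scoped ENNReal ContDiff Gradient

namespace SemiGeostrophic

/-- Three-dimensional Euclidean space. -/
abbrev E3 : Type := EuclideanSpace ℝ (Fin 3)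

/-- The matrix `J` encoding planetary rotation. -/
def matJ : Matrix (Fin 3) (Fin 3) ℝ :=
  !![0, -1, 0; 1, 0, 0; 0, 0, 0]

/-- The linear map `z ↦ J z` on Euclidean space. -/
noncomputable def J : E3 →L[ℝ] E3 := Matrix.toEuclideanCLM (𝕜 := ℝ) matJ

section Measures

/-- The Borel probability measures on `ℝ³` with compact support. -/
def ProbCompact : Set (Measure E3) :=
  {μ | IsProbabilityMeasure μ ∧ IsCompact μ.support}

/-- The couplings of `μ` and `ν`: probability measures on the product with marginals `μ`, `ν`. -/
def couplings (μ ν : Measure E3) : Set (Measure (E3 × E3)) :=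
  {γ | IsProbabilityMeasure γ ∧ γ.map Prod.fst = μ ∧ γ.map Prod.snd = ν}

/-- The Wasserstein 2-distance, with values in `[0, ∞]`
(it is finite on measures with finite second moments). -/
noncomputable def W2 (μ ν : Measure E3) : ℝ≥0∞ :=
  (⨅ γ ∈ couplings μ ν, ∫⁻ p, edist p.1 p.2 ^ 2 ∂γ) ^ (1 / 2 : ℝ)

/-- `α` restricts to an element of `C([0,T]; P_c(ℝ³))`, where the space of compactly supported
probability measures carries the Wasserstein 2-distance. Only the values of `α` on `[0,T]`
matter. -/
def IsContinuousCurve (T : ℝ) (α : ℝ → Measure E3) : Prop :=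
  (∀ t ∈ Icc 0 T, α t ∈ ProbCompact) ∧
    ∀ t ∈ Icc 0 T, Tendsto (fun s => W2 (α s) (α t)) (𝓝[Icc 0 T] t) (𝓝 0)

/-- Mass vectors: positive entries which sum to one. -/
def IsMassVector {N : ℕ} (m : Fin N → ℝ) : Prop :=
  (∀ i, 0 < m i) ∧ ∑ i, m i = 1

/-- Seed vectors: `N`-tuples of pairwise distinct points. -/
def seedVectors (N : ℕ) : Set (Fin N → E3) :=
  {z | ∀ i j, i ≠ j → z i ≠ z j}

/-- The discrete measure `∑ i, m i δ_{z i}`. -/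
noncomputable def discreteMeasure {N : ℕ} (m : Fin N → ℝ) (z : Fin N → E3) : Measure E3 :=
  ∑ i, ENNReal.ofReal (m i) • Measure.dirac (z i)

/-- The class of discrete probability measures with exactly `N` atoms. -/
def discreteMeasures (N : ℕ) : Set (Measure E3) :=
  {ν | ∃ (m : Fin N → ℝ) (z : Fin N → E3),
    IsMassVector m ∧ z ∈ seedVectors N ∧ ν = discreteMeasure m z}

/-- Well-preparedness: the seeds lie in distinct horizontal planes (`z i 2` is the third
coordinate `z i · e₃`). -/
def IsWellPrepared {N : ℕ} (z : Fin N → E3) : Prop :=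
  ∃ r : ℝ, 0 < r ∧ ∀ i j, i ≠ j → r ≤ |(z i - z j) 2|

end Measures

section OptimalTransport

/-- `g` is the weak gradient of `f` on the open set `Ω`:
`∫_Ω f ∇φ = - ∫_Ω φ g` for all test functions `φ` on `Ω`. -/
def IsWeakGradient (Ω : Set E3) (f : E3 → ℝ) (g : E3 → E3) : Prop :=
  ∀ φ : E3 → ℝ, ContDiff ℝ ∞ φ → HasCompactSupport φ → tsupport φ ⊆ Ω →
    ∫ x in Ω, f x • ∇ φ x = -∫ x in Ω, φ x • g x

/-- `f` belongs to the Sobolev space `H¹(Ω)`. -/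
def MemH1 (Ω : Set E3) (f : E3 → ℝ) : Prop :=
  MemLp f 2 (volume.restrict Ω) ∧
    ∃ g : E3 → E3, MemLp g 2 (volume.restrict Ω) ∧ IsWeakGradient Ω f g

/-- `S` is a transport map from Lebesgue measure on `Ω` to `ν`. (Borel maps on the open set `Ω`
are represented by Borel maps on the whole space; only their values on `Ω` matter.) -/
def IsTransportMap (Ω : Set E3) (ν : Measure E3) (S : E3 → E3) : Prop :=
  Measurable S ∧ (volume.restrict Ω).map S = ν

/-- `S` is an optimal transport map from Lebesgue measure on `Ω` to `ν` for the quadratic cost. -/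
def IsOptimalTransportMap (Ω : Set E3) (ν : Measure E3) (S : E3 → E3) : Prop :=
  IsTransportMap Ω ν S ∧
    ∀ S', IsTransportMap Ω ν S' →
      ∫⁻ x in Ω, edist x (S x) ^ 2 ≤ ∫⁻ x in Ω, edist x (S' x) ^ 2

/-- `Φ` is a mean-zero convex function in `H¹(Ω)` whose gradient is an optimal transport map from
Lebesgue measure on `Ω` to `ν`. Here `∇ Φ` is the pointwise gradient, which exists almost
everywhere on `Ω` and agrees almost everywhere with the weak gradient because `Φ` is convex. -/
structure IsBrenierPotential (Ω : Set E3) (ν : Measure E3) (Φ : E3 → ℝ) : Prop where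
  convexOn : ConvexOn ℝ Ω Φ
  memH1 : MemH1 Ω Φ
  mean_zero : ∫ x in Ω, Φ x = 0
  optimal : IsOptimalTransportMap Ω ν (∇ Φ)

open Classical in
/-- The operator sending `ν` to its mean-zero convex potential. By Brenier's theorem the
potential exists whenever `Ω` is open, bounded and convex of unit volume and `ν` is a probability
measure with finite second moment, and it is then unique as a function on `Ω`. -/
noncomputable def brenier (Ω : Set E3) (ν : Measure E3) : E3 → ℝ :=
  if h : ∃ Φ, IsBrenierPotential Ω ν Φ then h.choose else 0

end OptimalTransport

section Solutions

/-- The geostrophic energy (coordinates are numbered `0, 1, 2`). -/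
noncomputable def geostrophicEnergy (Ω : Set E3) (ν : Measure E3) : ℝ :=
  ∫ x in Ω, ((1 / 2) * ((∇ (brenier Ω ν) x 0 - x 0) ^ 2 + (∇ (brenier Ω ν) x 1 - x 1) ^ 2)
    - x 2 * ∇ (brenier Ω ν) x 2)

/-- Time derivative of a function of `(z, t)`. -/
noncomputable def dt (φ : E3 × ℝ → ℝ) (z : E3) (t : ℝ) : ℝ := deriv (fun s => φ (z, s)) t

/-- Spatial gradient of a function of `(z, t)`. -/
noncomputable def gradz (φ : E3 × ℝ → ℝ) (z : E3) (t : ℝ) : E3 := ∇ (fun y => φ (y, t)) z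

/-- Geostrophic solutions: weak measure-valued solutions on `[0,T]` of the semi-geostrophic
equations in geostrophic coordinates, with initial measure `α₀`. -/
def IsGeostrophicSolution (Ω : Set E3) (T : ℝ) (α₀ : Measure E3) (α : ℝ → Measure E3) : Prop :=
  IsContinuousCurve T α ∧
    ∀ φ : E3 × ℝ → ℝ, ContDiff ℝ ∞ φ → HasCompactSupport φ →
      (∫ t in (0 : ℝ)..T, ∫ z, (dt φ z t + inner ℝ (J z) (gradz φ z t)) ∂(α t))
        - (∫ t in (0 : ℝ)..T, ∫ x in Ω,
            inner ℝ (J x) (gradz φ (∇ (brenier Ω (α t)) x) t))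
      = (∫ z, φ (z, T) ∂(α T)) - ∫ z, φ (z, 0) ∂α₀

/-- Continuously differentiable discrete geostrophic solutions: geostrophic solutions of the form
`α_t = ∑ m_i δ_{z_i(t)}` on `[0,T]`, with some number `N` of distinct seeds moving along `C¹`
paths and a constant mass vector. -/
def IsC1DiscreteGeostrophicSolution (Ω : Set E3) (T : ℝ) (α₀ : Measure E3)
    (α : ℝ → Measure E3) : Prop :=
  IsGeostrophicSolution Ω T α₀ α ∧
    ∃ (N : ℕ) (m : Fin N → ℝ) (z : ℝ → Fin N → E3),
      IsMassVector m ∧ ContDiffOn ℝ 1 z (Icc 0 T) ∧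
        ∀ t ∈ Icc 0 T, α t = discreteMeasure m (z t) ∧ α t ∈ discreteMeasures N

/-- The geostrophic energy is constant in time on `[0,T]`. -/
def IsEnergyConserving (Ω : Set E3) (T : ℝ) (α : ℝ → Measure E3) : Prop :=
  ∀ s ∈ Icc 0 T, ∀ t ∈ Icc 0 T, geostrophicEnergy Ω (α s) = geostrophicEnergy Ω (α t)

end Solutions

end SemiGeostrophic

/-! For a discrete measure the Brenier map is piecewise constant: it sends each Laguerre cell of the
seeds, with weights tuned so that the cells have volumes `m`, to its seed. The weak equation then
sees the domain only through the centroids `c i` of the cells and becomes the ODE `z i' = J (z i - c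
i(z))`. The theorem is thus global well-posedness of this ODE, together with the equivalence between
the ODE and the weak formulation.

Everything rests on a quantitative stability of cells. Adapted weights exist because they minimise
the Kantorovich dual functional (`IsUnitDomain.exists_isAdapted`). When the seeds move by `δ`,
weight differences change by at most a multiple of `δ`; this follows from the connectedness of `Ω`
alone (`IsUnitDomain.weight_sub_le`). Points that change cell therefore lie in thin slabs around the
interfaces, and the centroids are Lipschitz in the seeds, with a constant depending on the seed
separation (`IsUnitDomain.norm_centroid_sub_le`).

Since `J` has no vertical component, the height of each seed is conserved, so well-prepared seeds
stay separated. Freezing the heights in the nonlinear term makes it globally Lipschitz and bounded,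
which yields existence on all of `[0, T]` and uniqueness (`IsUnitDomain.exists_isSeedFlow`,
`IsSeedFlow.eqOn`). Conversely, localised test functions show that the seeds of any C¹ discrete
solution obey the ODE and start, after relabelling, at the given seeds
(`IsC1DiscreteGeostrophicSolution.exists_isSeedFlow`).

Energy is conserved because the transport part has gradient `m i • c i` in the `i`-th seed (an
envelope argument, `IsUnitDomain.hasDerivWithinAt_correlation`), so the time derivative is a sum of
terms `⟪a, J a⟫ = 0` (`IsSeedFlow.geostrophicEnergy_eq`). -/

namespace SemiGeostrophic

/-! ### Slab volumes, Laguerre cells and adapted weights -/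

section Laguerre

/-- A convex open set of unit volume contained in the closed ball of radius `R` about the origin. -/
structure IsUnitDomain (Ω : Set E3) (R : ℝ) : Prop where
  isOpen : IsOpen Ω
  convex : Convex ℝ Ω
  volume_eq : volume Ω = 1
  radius_pos : 0 < R
  norm_le : ∀ x ∈ Ω, ‖x‖ ≤ R

/-- A constant for the volume of slabs in the ball of radius `R`. -/
noncomputable def slabConst (R : ℝ) : ℝ := 3 * volume.real (Metric.closedBall (0 : E3) (2 * R)) / R

lemma slabConst_nonneg {R : ℝ} (hR : 0 < R) : 0 ≤ slabConst R := by
  unfold slabConst; positivity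

/-- A packing argument: translates of the slab along `v` with spacing `3 * ε / ‖v‖` are pairwise
disjoint, and about `R * ‖v‖ / (3 * ε)` of them fit in the ball of radius `2 * R`. The constant is
crude; only linearity in `ε / ‖v‖` matters. -/
lemma volume_slab_le_of_pos {R : ℝ} (hR : 0 < R) {v : E3} (hv : v ≠ 0) (c : ℝ) {ε : ℝ}
    (hε : 0 < ε) :
    volume {x : E3 | ‖x‖ ≤ R ∧ |inner ℝ x v + c| ≤ ε} ≤
      ENNReal.ofReal (slabConst R * ε / ‖v‖) := by
  set A : Set E3 := {x : E3 | ‖x‖ ≤ R ∧ |inner ℝ x v + c| ≤ ε} with hA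
  have hvpos : 0 < ‖v‖ := norm_pos_iff.2 hv
  have hAcl : IsClosed A := by
    have h2 : Continuous fun x : E3 => |inner ℝ x v + c| := by fun_prop
    exact (isClosed_le continuous_norm continuous_const).inter (isClosed_le h2 continuous_const)
  -- `y` counts how many steps of length `3 * ε / ‖v‖` make up a shift by `R`.
  set y : ℝ := R * ‖v‖ / (3 * ε) with hy
  have hypos : 0 < y := by positivity
  set n : ℕ := ⌊y⌋₊ + 1 with hn
  set u : E3 := (3 * ε / ‖v‖ ^ 2) • v with hu
  have huv : inner ℝ u v = 3 * ε := by
    rw [hu, inner_smul_left, real_inner_self_eq_norm_sq]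
    simp only [conj_trivial]
    field_simp
  have hun : ‖u‖ = 3 * ε / ‖v‖ := by
    rw [hu, norm_smul, Real.norm_of_nonneg (by positivity)]
    field_simp
  let B : ℕ → Set E3 := fun j => (fun x => x + (-((j : ℝ) • u))) ⁻¹' A
  have hBvol : ∀ j, volume (B j) = volume A := fun j => measure_preimage_add_right _ _ _
  have hBmeas : ∀ j, MeasurableSet (B j) := fun j =>
    (hAcl.preimage (by fun_prop)).measurableSet
  have hBdisj : ∀ i j, i < j → Disjoint (B i) (B j) := by
    intro i j hij
    rw [Set.disjoint_left]
    rintro x ⟨-, hxi⟩ ⟨-, hxj⟩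
    simp only [inner_add_left, inner_neg_left, inner_smul_left, huv, conj_trivial, abs_le]
      at hxi hxj
    have : (i : ℝ) + 1 ≤ j := by exact_mod_cast hij
    nlinarith [hxi.1, hxi.2, hxj.1, hxj.2]
  have hsub : (⋃ j ∈ Finset.range n, B j) ⊆ Metric.closedBall (0 : E3) (2 * R) := by
    intro x hx
    simp only [mem_iUnion, Finset.mem_range] at hx
    obtain ⟨j, hj, hxj, -⟩ := hx
    have hjy : (j : ℝ) ≤ y :=
      (Nat.cast_le.2 (Nat.lt_succ_iff.1 hj)).trans (Nat.floor_le hypos.le)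
    have h1 : ‖(j : ℝ) • u‖ ≤ R := by
      rw [norm_smul, hun, Real.norm_of_nonneg (Nat.cast_nonneg _)]
      calc (j : ℝ) * (3 * ε / ‖v‖) ≤ y * (3 * ε / ‖v‖) := by gcongr
        _ = R := by rw [hy]; field_simp
    rw [mem_closedBall_zero_iff]
    have h2 : x = (x + -((j : ℝ) • u)) + (j : ℝ) • u := by abel
    rw [h2]
    exact (norm_add_le _ _).trans (by linarith)
  have hsum : (n : ℝ≥0∞) * volume A ≤ volume (Metric.closedBall (0 : E3) (2 * R)) := by
    have := measure_mono (μ := volume) hsub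
    rw [measure_biUnion_finset (fun i _ j _ hij => by
      rcases lt_or_gt_of_ne hij with h | h
      · exact hBdisj i j h
      · exact (hBdisj j i h).symm) (fun j _ => hBmeas j)] at this
    simpa [hBvol] using this
  have hfin : volume (Metric.closedBall (0 : E3) (2 * R)) ≠ ⊤ := measure_closedBall_lt_top.ne
  have hAfin : volume A ≠ ⊤ := by
    refine ne_top_of_le_ne_top (measure_closedBall_lt_top (x := (0 : E3)) (r := R)).ne
      (measure_mono fun x hx => ?_)
    simpa using hx.1
  have hreal : (n : ℝ) * volume.real A ≤ volume.real (Metric.closedBall (0 : E3) (2 * R)) := by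
    have := ENNReal.toReal_mono hfin hsum
    simpa [Measure.real, ENNReal.toReal_mul] using this
  have hny : y ≤ n := by rw [hn]; push_cast; exact (Nat.lt_floor_add_one y).le
  rw [← ofReal_measureReal hAfin]
  refine ENNReal.ofReal_le_ofReal ?_
  have h3 : y * volume.real A ≤ volume.real (Metric.closedBall (0 : E3) (2 * R)) :=
    (mul_le_mul_of_nonneg_right hny measureReal_nonneg).trans hreal
  have h4 : volume.real A ≤ volume.real (Metric.closedBall (0 : E3) (2 * R)) / y := by
    rw [le_div_iff₀ hypos]; linarith
  refine h4.trans (le_of_eq ?_)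
  rw [hy, slabConst]
  field_simp

/-- Letting the width decrease to `ε` admits `ε = 0`, which says that hyperplanes, hence interfaces
between cells, are null. -/
lemma volume_slab_le {R : ℝ} (hR : 0 < R) {v : E3} (hv : v ≠ 0) (c : ℝ) {ε : ℝ} (hε : 0 ≤ ε) :
    volume {x : E3 | ‖x‖ ≤ R ∧ |inner ℝ x v + c| ≤ ε} ≤
      ENNReal.ofReal (slabConst R * ε / ‖v‖) := by
  have hlim : Tendsto (fun s : ℝ => ENNReal.ofReal (slabConst R * s / ‖v‖)) (𝓝[>] ε)
      (𝓝 (ENNReal.ofReal (slabConst R * ε / ‖v‖))) :=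
    (ENNReal.continuous_ofReal.comp (by fun_prop :
      Continuous fun s : ℝ => slabConst R * s / ‖v‖)).continuousWithinAt
  refine ge_of_tendsto hlim ?_
  filter_upwards [self_mem_nhdsWithin] with s hs
  have hs' : ε ≤ s := le_of_lt hs
  refine le_trans (measure_mono ?_)
    (volume_slab_le_of_pos hR hv c (hε.trans_lt hs))
  exact fun x hx => ⟨hx.1, hx.2.trans hs'⟩

variable {N : ℕ}

/-- The closed Laguerre cell of the seed `z i` for the weights `w`. -/
def cell (z : Fin N → E3) (w : Fin N → ℝ) (i : Fin N) : Set E3 :=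
  {x | ∀ j, inner ℝ x (z j) + w j ≤ inner ℝ x (z i) + w i}

/-- The upper envelope of the affine functions `x ↦ ⟪x, z j⟫ + w j`. -/
noncomputable def envelope (z : Fin N → E3) (w : Fin N → ℝ) (x : E3) : ℝ :=
  ⨆ j, (inner ℝ x (z j) + w j)

lemma le_envelope (z : Fin N → E3) (w : Fin N → ℝ) (x : E3) (j : Fin N) :
    inner ℝ x (z j) + w j ≤ envelope z w x :=
  le_ciSup (f := fun j => inner ℝ x (z j) + w j) (Set.finite_range _).bddAbove j

lemma envelope_le [NeZero N] {z : Fin N → E3} {w : Fin N → ℝ} {x : E3} {b : ℝ}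
    (h : ∀ j, inner ℝ x (z j) + w j ≤ b) : envelope z w x ≤ b := ciSup_le h

lemma envelope_eq_of_mem_cell {z : Fin N → E3} {w : Fin N → ℝ} {x : E3} {i : Fin N}
    (h : x ∈ cell z w i) : envelope z w x = inner ℝ x (z i) + w i :=
  haveI : NeZero N := ⟨by rintro rfl; exact i.elim0⟩
  le_antisymm (envelope_le h) (le_envelope z w x i)

lemma mem_cell_of_envelope_le {z : Fin N → E3} {w : Fin N → ℝ} {x : E3} {i : Fin N}
    (h : envelope z w x ≤ inner ℝ x (z i) + w i) : x ∈ cell z w i :=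
  fun j => (le_envelope z w x j).trans h

lemma exists_mem_cell [NeZero N] (z : Fin N → E3) (w : Fin N → ℝ) (x : E3) :
    ∃ i, x ∈ cell z w i := by
  obtain ⟨i, hi⟩ := exists_eq_ciSup_of_finite (f := fun j => inner ℝ x (z j) + w j)
  exact ⟨i, mem_cell_of_envelope_le hi.ge⟩

lemma isClosed_cell (z : Fin N → E3) (w : Fin N → ℝ) (i : Fin N) : IsClosed (cell z w i) := by
  simp only [cell, ofPred_forall]
  exact isClosed_iInter fun j => isClosed_le (by fun_prop) (by fun_prop)

lemma IsUnitDomain.aedisjoint_cell {Ω : Set E3} {R : ℝ} (hΩ : IsUnitDomain Ω R)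
    {z : Fin N → E3} {w : Fin N → ℝ} {i j : Fin N} (hij : z i ≠ z j) :
    volume (Ω ∩ (cell z w i ∩ cell z w j)) = 0 := by
  have h := volume_slab_le hΩ.radius_pos (sub_ne_zero.2 hij) (w i - w j) le_rfl
  simp only [mul_zero, zero_div, ENNReal.ofReal_zero, nonpos_iff_eq_zero] at h
  refine measure_mono_null ?_ h
  rintro x ⟨hx, hi, hj⟩
  refine ⟨hΩ.norm_le x hx, ?_⟩
  rw [inner_sub_right, abs_nonpos_iff]
  linarith [hi j, hj i]

lemma IsUnitDomain.pairwise_aedisjoint {Ω : Set E3} {R : ℝ} (hΩ : IsUnitDomain Ω R)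
    {z : Fin N → E3} (hz : z ∈ seedVectors N) (w : Fin N → ℝ) :
    Pairwise (Function.onFun (AEDisjoint volume) fun i => Ω ∩ cell z w i) := by
  intro i j hij
  have := hΩ.aedisjoint_cell (w := w) (hz i j hij)
  refine measure_mono_null ?_ this
  rintro x ⟨⟨h1, h2⟩, -, h3⟩
  exact ⟨h1, h2, h3⟩

lemma IsUnitDomain.measurableSet_cell {Ω : Set E3} {R : ℝ} (hΩ : IsUnitDomain Ω R)
    (z : Fin N → E3) (w : Fin N → ℝ) (i : Fin N) : MeasurableSet (Ω ∩ cell z w i) :=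
  hΩ.isOpen.measurableSet.inter (isClosed_cell z w i).measurableSet

lemma IsUnitDomain.volume_biUnion_cell {Ω : Set E3} {R : ℝ} (hΩ : IsUnitDomain Ω R)
    {z : Fin N → E3} (hz : z ∈ seedVectors N) (w : Fin N → ℝ) (A : Finset (Fin N)) :
    volume (⋃ i ∈ A, Ω ∩ cell z w i) = ∑ i ∈ A, volume (Ω ∩ cell z w i) :=
  measure_biUnion_finset₀ (fun _ _ _ _ hij => hΩ.pairwise_aedisjoint hz w hij)
    fun i _ => (hΩ.measurableSet_cell z w i).nullMeasurableSet

lemma biUnion_cell [NeZero N] (Ω : Set E3) (z : Fin N → E3) (w : Fin N → ℝ) :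
    ⋃ i ∈ (Finset.univ : Finset (Fin N)), Ω ∩ cell z w i = Ω := by
  ext x
  simp only [Finset.mem_univ, iUnion_true, mem_iUnion, mem_inter_iff, exists_and_left]
  exact ⟨fun h => h.1, fun h => ⟨h, exists_mem_cell z w x⟩⟩

lemma IsUnitDomain.sum_volume_cell [NeZero N] {Ω : Set E3} {R : ℝ} (hΩ : IsUnitDomain Ω R)
    {z : Fin N → E3} (hz : z ∈ seedVectors N) (w : Fin N → ℝ) :
    ∑ i, volume (Ω ∩ cell z w i) = 1 := by
  rw [← hΩ.volume_biUnion_cell hz, biUnion_cell, hΩ.volume_eq]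

/-- The Laguerre cells of `(z, w)` have the volumes `m`. -/
def IsAdapted (Ω : Set E3) (m : Fin N → ℝ) (z : Fin N → E3) (w : Fin N → ℝ) : Prop :=
  ∀ i, volume (Ω ∩ cell z w i) = ENNReal.ofReal (m i)

lemma IsMassVector.neZero {m : Fin N → ℝ} (hm : IsMassVector m) : NeZero N :=
  ⟨by rintro rfl; simpa using hm.2⟩

/-! ### Existence of adapted weights -/

lemma abs_envelope_sub_le [NeZero N] (z z' : Fin N → E3) (w w' : Fin N → ℝ) (x y : E3) {b : ℝ}
    (h : ∀ j, |(inner ℝ x (z j) + w j) - (inner ℝ y (z' j) + w' j)| ≤ b) :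
    |envelope z w x - envelope z' w' y| ≤ b := by
  rw [abs_le]
  constructor
  · have : envelope z' w' y ≤ envelope z w x + b := envelope_le fun j => by
      linarith [(abs_le.1 (h j)).1, le_envelope z w x j]
    linarith
  · have : envelope z w x ≤ envelope z' w' y + b := envelope_le fun j => by
      linarith [(abs_le.1 (h j)).2, le_envelope z' w' y j]
    linarith

lemma lipschitzWith_envelope [NeZero N] (z : Fin N → E3) (w : Fin N → ℝ) :
    LipschitzWith ‖z‖₊ (envelope z w) := by
  refine LipschitzWith.of_dist_le_mul fun x y => ?_
  rw [Real.dist_eq, dist_eq_norm]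
  refine abs_envelope_sub_le z z w w x y fun j => ?_
  rw [add_sub_add_right_eq_sub, ← inner_sub_left]
  refine (abs_real_inner_le_norm _ _).trans ?_
  rw [mul_comm]
  gcongr
  exact norm_le_pi_norm z j

lemma convexOn_envelope [NeZero N] (z : Fin N → E3) (w : Fin N → ℝ) {s : Set E3}
    (hs : Convex ℝ s) : ConvexOn ℝ s (envelope z w) := by
  refine ⟨hs, fun x _ y _ a b ha hb hab => envelope_le fun j => ?_⟩
  rw [inner_add_left, inner_smul_left, inner_smul_left]
  simp only [conj_trivial, smul_eq_mul]
  have h1 := mul_le_mul_of_nonneg_left (le_envelope z w x j) ha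
  have h2 := mul_le_mul_of_nonneg_left (le_envelope z w y j) hb
  have : w j = a * w j + b * w j := by rw [← add_mul, hab, one_mul]
  linarith

lemma IsUnitDomain.integrableOn {Ω : Set E3} {R : ℝ} (hΩ : IsUnitDomain Ω R) {F : Type*}
    [NormedAddCommGroup F] {f : E3 → F} (hf : Continuous f) : IntegrableOn f Ω := by
  refine (hf.continuousOn.integrableOn_compact
    (isCompact_closedBall (0 : E3) R)).mono_set fun x hx => ?_
  simpa using hΩ.norm_le x hx

lemma IsUnitDomain.volume_ne_top {Ω : Set E3} {R : ℝ} (hΩ : IsUnitDomain Ω R) (s : Set E3) :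
    volume (Ω ∩ s) ≠ ⊤ :=
  ne_top_of_le_ne_top (by rw [hΩ.volume_eq]; simp) (measure_mono inter_subset_left)

lemma IsUnitDomain.real_eq {Ω : Set E3} {R : ℝ} (hΩ : IsUnitDomain Ω R) :
    volume.real Ω = 1 := by simp [Measure.real, hΩ.volume_eq]

lemma IsUnitDomain.norm_integral_le {Ω : Set E3} {R : ℝ} (hΩ : IsUnitDomain Ω R) {F : Type*}
    [NormedAddCommGroup F] [NormedSpace ℝ F] {f : E3 → F} {C : ℝ} (h : ∀ x ∈ Ω, ‖f x‖ ≤ C) :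
    ‖∫ x in Ω, f x‖ ≤ C := by
  have := norm_setIntegral_le_of_norm_le_const (μ := volume) (by rw [hΩ.volume_eq]; simp) h
  rwa [hΩ.real_eq, mul_one] at this

lemma envelope_add_const [NeZero N] (z : Fin N → E3) (w : Fin N → ℝ) (c : ℝ) (x : E3) :
    envelope z (fun i => w i + c) x = envelope z w x + c := by
  obtain ⟨i, hi⟩ := exists_mem_cell z w x
  have h : x ∈ cell z (fun i => w i + c) i := fun j => by have := hi j; simp only; linarith
  rw [envelope_eq_of_mem_cell h, envelope_eq_of_mem_cell hi, add_assoc]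

/-- The (negative) Kantorovich dual functional. -/
noncomputable def dualFun (Ω : Set E3) (m : Fin N → ℝ) (z : Fin N → E3) (w : Fin N → ℝ) : ℝ :=
  (∫ x in Ω, envelope z w x) - ∑ i, m i * w i

lemma IsUnitDomain.integrableOn_envelope [NeZero N] {Ω : Set E3} {R : ℝ} (hΩ : IsUnitDomain Ω R)
    (z : Fin N → E3) (w : Fin N → ℝ) : IntegrableOn (envelope z w) Ω :=
  hΩ.integrableOn (lipschitzWith_envelope z w).continuous

lemma IsUnitDomain.continuous_dualFun [NeZero N] {Ω : Set E3} {R : ℝ} (hΩ : IsUnitDomain Ω R)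
    (m : Fin N → ℝ) (z : Fin N → E3) : Continuous (dualFun Ω m z) := by
  refine Continuous.sub ?_ (by fun_prop)
  refine (LipschitzWith.of_dist_le_mul (K := 1) fun w w' => ?_).continuous
  rw [Real.dist_eq, ← integral_sub (hΩ.integrableOn_envelope z w) (hΩ.integrableOn_envelope z w')]
  rw [NNReal.coe_one, one_mul, ← Real.norm_eq_abs]
  refine hΩ.norm_integral_le fun x _ => ?_
  refine abs_envelope_sub_le z z w w' x x fun j => ?_
  rw [add_sub_add_left_eq_sub, ← Real.dist_eq]
  exact dist_le_pi_dist w w' j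

lemma IsUnitDomain.dualFun_add_const [NeZero N] {Ω : Set E3} {R : ℝ} (hΩ : IsUnitDomain Ω R)
    {m : Fin N → ℝ} (hm : IsMassVector m) (z : Fin N → E3) (w : Fin N → ℝ) (c : ℝ) :
    dualFun Ω m z (fun i => w i + c) = dualFun Ω m z w := by
  unfold dualFun
  simp_rw [envelope_add_const, mul_add, Finset.sum_add_distrib, ← Finset.sum_mul, hm.2]
  rw [integral_add (hΩ.integrableOn_envelope z w) (hΩ.integrableOn continuous_const)]
  simp [hΩ.real_eq]

/-- Adding a constant to the weights changes nothing, so the largest weight may be taken to be `0`.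
A very negative weight then makes the functional exceed its value at `0`, so the minimum over a
compact box is global. -/
lemma IsUnitDomain.exists_forall_dualFun_le [NeZero N] {Ω : Set E3} {R : ℝ}
    (hΩ : IsUnitDomain Ω R) {m : Fin N → ℝ} (hm : IsMassVector m) (z : Fin N → E3) :
    ∃ w, ∀ w', dualFun Ω m z w ≤ dualFun Ω m z w' := by
  obtain ⟨k, hk⟩ := Finite.exists_min m
  -- With `m k` the smallest mass, a weight below `-C` contributes at least `2 * (R * ‖z‖)`: one
  -- half offsets the lower bound for the integral, the other reaches the bound for the value at
  -- `0`.
  set C : ℝ := 2 * (R * ‖z‖) / m k with hC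
  have hR := hΩ.radius_pos
  have hmk := hm.1 k
  have hC0 : 0 ≤ C := by positivity
  have hcs : ∀ x ∈ Ω, ∀ j, |inner ℝ x (z j)| ≤ R * ‖z‖ := fun x hx j =>
    (abs_real_inner_le_norm _ _).trans
      (mul_le_mul (hΩ.norm_le x hx) (norm_le_pi_norm z j) (norm_nonneg _) hR.le)
  have h0 : dualFun Ω m z 0 ≤ R * ‖z‖ := by
    simp only [dualFun, Pi.zero_apply, mul_zero, Finset.sum_const_zero, sub_zero]
    refine (Real.le_norm_self _).trans (hΩ.norm_integral_le fun x hx => ?_)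
    obtain ⟨i, hi⟩ := exists_mem_cell z 0 x
    rw [envelope_eq_of_mem_cell hi]
    simpa using hcs x hx i
  obtain ⟨w, hwK, hw⟩ := (isCompact_Icc (a := fun _ : Fin N => -C) (b := 0)).exists_isMinOn
    ⟨0, fun i => by simpa using hC0, le_rfl⟩ (hΩ.continuous_dualFun m z).continuousOn
  refine ⟨w, fun w' => ?_⟩
  obtain ⟨l, hl⟩ := Finite.exists_max w'
  rw [← hΩ.dualFun_add_const hm z w' (-(w' l))]
  set v : Fin N → ℝ := fun i => w' i + -(w' l) with hv
  have hv0 : ∀ i, v i ≤ 0 := fun i => by simp only [hv]; linarith [hl i]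
  have hvl : v l = 0 := by simp [hv]
  by_cases hmem : ∀ i, -C ≤ v i
  · exact hw ⟨hmem, hv0⟩
  · push Not at hmem
    obtain ⟨j, hj⟩ := hmem
    have hle0 : dualFun Ω m z w ≤ dualFun Ω m z 0 :=
      hw ⟨fun i => by simpa using hC0, le_rfl⟩
    refine hle0.trans (h0.trans ?_)
    have h1 : -(R * ‖z‖) ≤ ∫ x in Ω, envelope z v x := by
      have : ∫ x in Ω, (-(R * ‖z‖)) ≤ ∫ x in Ω, envelope z v x := by
        refine setIntegral_mono_on (hΩ.integrableOn continuous_const)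
          (hΩ.integrableOn_envelope z v) hΩ.isOpen.measurableSet fun x hx => ?_
        have := le_envelope z v x l
        rw [hvl] at this
        linarith [(abs_le.1 (hcs x hx l)).1]
      simpa [hΩ.real_eq] using this
    have h2 : ∑ i, m i * v i ≤ m j * v j := by
      rw [← Finset.add_sum_erase _ _ (Finset.mem_univ j)]
      have : ∑ i ∈ Finset.univ.erase j, m i * v i ≤ 0 :=
        Finset.sum_nonpos fun i _ => mul_nonpos_of_nonneg_of_nonpos (hm.1 i).le (hv0 i)
      linarith
    have h3 : m j * v j ≤ -(2 * (R * ‖z‖)) := by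
      have : m j * v j ≤ m k * -C :=
        calc m j * v j ≤ m k * v j := mul_le_mul_of_nonpos_right (hk j) (hv0 j)
          _ ≤ m k * -C := mul_le_mul_of_nonneg_left hj.le hmk.le
      refine this.trans (le_of_eq ?_)
      rw [hC]; field_simp
    unfold dualFun
    linarith

lemma envelope_sub_le_indicator [NeZero N] (z : Fin N → E3) (w : Fin N → ℝ) (i : Fin N)
    (ε : ℝ) (x : E3) :
    envelope z (w + Pi.single i ε) x - envelope z w x ≤
      (cell z (w + Pi.single i ε) i).indicator (fun _ => ε) x := by
  obtain ⟨k, hk⟩ := exists_mem_cell z (w + Pi.single i ε) x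
  by_cases hx : x ∈ cell z (w + Pi.single i ε) i
  · rw [indicator_of_mem hx, envelope_eq_of_mem_cell hx]
    have := le_envelope z w x i
    simp only [Pi.add_apply, Pi.single_eq_same]
    linarith
  · rw [indicator_of_notMem hx, envelope_eq_of_mem_cell hk]
    have hki : k ≠ i := by rintro rfl; exact hx hk
    have := le_envelope z w x k
    simp only [Pi.add_apply, Pi.single_eq_of_ne hki]
    linarith

/-- A one-sided first variation: raising the `i`-th weight by `ε` raises the envelope by at most
`ε`, and only on the enlarged cell. Minimality then bounds the volume of that cell from below,
without differentiating the functional. -/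
lemma IsUnitDomain.le_volume_cell_add [NeZero N] {Ω : Set E3} {R : ℝ} (hΩ : IsUnitDomain Ω R)
    {m : Fin N → ℝ} {z : Fin N → E3} {w : Fin N → ℝ}
    (hw : ∀ w', dualFun Ω m z w ≤ dualFun Ω m z w') (i : Fin N) {ε : ℝ} (hε : 0 < ε) :
    ENNReal.ofReal (m i) ≤ volume (Ω ∩ cell z (w + Pi.single i ε) i) := by
  have h1 := hw (w + Pi.single i ε)
  have h2 : ∫ x in Ω, (envelope z (w + Pi.single i ε) x - envelope z w x) ≤
      ∫ x in Ω, (cell z (w + Pi.single i ε) i).indicator (fun _ => ε) x := by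
    refine integral_mono ((hΩ.integrableOn_envelope _ _).sub (hΩ.integrableOn_envelope _ _)) ?_
      (envelope_sub_le_indicator z w i ε)
    exact (hΩ.integrableOn continuous_const).integrable.indicator
      (isClosed_cell _ _ _).measurableSet
  rw [integral_sub (hΩ.integrableOn_envelope _ _) (hΩ.integrableOn_envelope _ _),
    setIntegral_indicator (isClosed_cell _ _ _).measurableSet, setIntegral_const] at h2
  have h3 : ∑ j, m j * (w + Pi.single i ε : Fin N → ℝ) j = (∑ j, m j * w j) + m i * ε := by
    simp [mul_add, Finset.sum_add_distrib, Pi.single_apply]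
  unfold dualFun at h1
  rw [h3] at h1
  have h4 : m i * ε ≤ volume.real (Ω ∩ cell z (w + Pi.single i ε) i) * ε := by
    rw [smul_eq_mul] at h2; linarith
  rw [← ofReal_measureReal (hΩ.volume_ne_top _)]
  exact ENNReal.ofReal_le_ofReal (le_of_mul_le_mul_right h4 hε)

/-- For a minimiser, the enlarged cells shrink to the cell itself as `ε → 0`, so every cell has
volume at least `m i`. Both families sum to `1`, which forces equality. -/
lemma IsUnitDomain.exists_isAdapted {Ω : Set E3} {R : ℝ} (hΩ : IsUnitDomain Ω R)
    {m : Fin N → ℝ} (hm : IsMassVector m) {z : Fin N → E3} (hz : z ∈ seedVectors N) :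
    ∃ w, IsAdapted Ω m z w := by
  have := hm.neZero
  obtain ⟨w, hw⟩ := hΩ.exists_forall_dualFun_le hm z
  have hle : ∀ i, ENNReal.ofReal (m i) ≤ volume (Ω ∩ cell z w i) := by
    intro i
    let s : ℕ → Set E3 := fun n => Ω ∩ cell z (w + Pi.single i (1 / ((n : ℝ) + 1))) i
    have hval : ∀ (ε : ℝ) (x : E3), x ∈ cell z (w + Pi.single i ε) i ↔
        ∀ j, j ≠ i → inner ℝ x (z j) + w j ≤ inner ℝ x (z i) + w i + ε := by
      intro ε x
      refine ⟨fun h j hj => ?_, fun h j => ?_⟩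
      · have := h j
        simp only [Pi.add_apply, Pi.single_eq_of_ne hj, Pi.single_eq_same] at this
        linarith
      · by_cases hj : j = i
        · rw [hj]
        · simp only [Pi.add_apply, Pi.single_eq_of_ne hj, Pi.single_eq_same]
          linarith [h j hj]
    have hanti : Antitone s := by
      intro a b hab x hx
      refine ⟨hx.1, (hval _ x).2 fun j hj => ((hval _ x).1 hx.2 j hj).trans ?_⟩
      gcongr
    have hint : ⋂ n, s n = Ω ∩ cell z w i := by
      ext x
      simp only [mem_iInter, s, mem_inter_iff]
      constructor
      · intro h
        refine ⟨(h 0).1, fun j => ?_⟩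
        by_cases hj : j = i
        · rw [hj]
        have hlim : Tendsto (fun n : ℕ => inner ℝ x (z i) + w i + 1 / ((n : ℝ) + 1)) atTop
            (𝓝 (inner ℝ x (z i) + w i + 0)) :=
          tendsto_const_nhds.add tendsto_one_div_add_atTop_nhds_zero_nat
        rw [add_zero] at hlim
        exact ge_of_tendsto' hlim fun n => (hval _ x).1 (h n).2 j hj
      · rintro ⟨h1, h2⟩ n
        refine ⟨h1, (hval _ x).2 fun j _ => (h2 j).trans ?_⟩
        have : 0 ≤ 1 / ((n : ℝ) + 1) := by positivity
        linarith
    have hlim := tendsto_measure_iInter_atTop (μ := volume) (s := s)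
      (fun n => (hΩ.measurableSet_cell _ _ _).nullMeasurableSet) hanti ⟨0, hΩ.volume_ne_top _⟩
    rw [hint] at hlim
    exact ge_of_tendsto' hlim fun n => hΩ.le_volume_cell_add hw i (by positivity)
  refine ⟨w, fun i => le_antisymm ?_ (hle i)⟩
  by_contra! hlt
  have hsum : ∑ j, ENNReal.ofReal (m j) < ∑ j, volume (Ω ∩ cell z w j) := by
    rw [← Finset.add_sum_erase _ _ (Finset.mem_univ i),
      ← Finset.add_sum_erase _ (fun j => volume (Ω ∩ cell z w j)) (Finset.mem_univ i)]
    refine ENNReal.add_lt_add_of_lt_of_le ?_ hlt (Finset.sum_le_sum fun j _ => hle j)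
    exact (ENNReal.sum_lt_top.2 fun j _ => ENNReal.ofReal_lt_top).ne
  rw [hΩ.sum_volume_cell hz w, ← ENNReal.ofReal_sum_of_nonneg fun j _ => (hm.1 j).le, hm.2] at hsum
  simp at hsum

end Laguerre

/-! ### Stability of weights, moments and centroids -/

section Stability

variable {N : ℕ} {Ω : Set E3} {R : ℝ}

/-- Otherwise the old cells indexed by `A` and the new cells indexed by `Aᶜ` are disjoint in `Ω`.
Their volumes add up to `1`, so these two closed sets cover `Ω`, both meeting it; this contradicts
connectedness. -/
lemma IsUnitDomain.exists_weight_sub_le (hΩ : IsUnitDomain Ω R) {m : Fin N → ℝ}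
    (hm : IsMassVector m) {z z' : Fin N → E3} (hz : z ∈ seedVectors N) (hz' : z' ∈ seedVectors N)
    {w w' : Fin N → ℝ} (hw : IsAdapted Ω m z w) (hw' : IsAdapted Ω m z' w')
    {A : Finset (Fin N)} (hA : A.Nonempty) (hA' : Aᶜ.Nonempty) :
    ∃ i ∈ A, ∃ j ∉ A, (w' i - w i) - (w' j - w j) ≤ 2 * R * ‖z - z'‖ := by
  have := hm.neZero
  by_contra! hcon
  set U : Set E3 := ⋃ i ∈ A, cell z w i with hU
  set V : Set E3 := ⋃ j ∈ Aᶜ, cell z' w' j with hV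
  have hUcl : IsClosed U := isClosed_biUnion_finset fun i _ => isClosed_cell z w i
  have hVcl : IsClosed V := isClosed_biUnion_finset fun i _ => isClosed_cell z' w' i
  have hdisj : Disjoint (Ω ∩ U) (Ω ∩ V) := by
    rw [Set.disjoint_left]
    rintro x ⟨hx, hxU⟩ ⟨-, hxV⟩
    simp only [hU, hV, mem_iUnion, Finset.mem_compl, exists_prop] at hxU hxV
    obtain ⟨i, hi, hxi⟩ := hxU
    obtain ⟨j, hj, hxj⟩ := hxV
    have h1 := hxi j
    have h2 := hxj i
    have h3 := hcon i hi j hj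
    have h4 : ∀ k, |inner ℝ x (z k) - inner ℝ x (z' k)| ≤ R * ‖z - z'‖ := fun k => by
      rw [← inner_sub_right]
      exact (abs_real_inner_le_norm _ _).trans (mul_le_mul (hΩ.norm_le x hx)
        (norm_le_pi_norm (z - z') k) (norm_nonneg _) hΩ.radius_pos.le)
    linarith [(abs_le.1 (h4 i)).2, (abs_le.1 (h4 j)).1]
  have hUvol : volume (Ω ∩ U) = ∑ i ∈ A, ENNReal.ofReal (m i) := by
    rw [hU, inter_iUnion₂, hΩ.volume_biUnion_cell hz]
    exact Finset.sum_congr rfl fun i _ => hw i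
  have hVvol : volume (Ω ∩ V) = ∑ i ∈ Aᶜ, ENNReal.ofReal (m i) := by
    rw [hV, inter_iUnion₂, hΩ.volume_biUnion_cell hz']
    exact Finset.sum_congr rfl fun i _ => hw' i
  have hne : ∀ {B : Finset (Fin N)}, B.Nonempty → ∑ i ∈ B, ENNReal.ofReal (m i) ≠ 0 := by
    rintro B ⟨i, hi⟩ h0
    rw [Finset.sum_eq_zero_iff] at h0
    exact (ENNReal.ofReal_pos.2 (hm.1 i)).ne' (h0 i hi)
  have hcover : Ω ⊆ U ∪ V := by
    -- The uncovered part is open and null, hence empty.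
    have hopen : IsOpen (Ω \ (U ∪ V)) := hΩ.isOpen.sdiff (hUcl.union hVcl)
    have htot : volume (Ω ∩ (U ∪ V)) = 1 := by
      rw [inter_union_distrib_left, measure_union hdisj
        (hΩ.isOpen.measurableSet.inter hVcl.measurableSet), hUvol, hVvol,
        Finset.sum_add_sum_compl, ← ENNReal.ofReal_sum_of_nonneg fun j _ => (hm.1 j).le, hm.2,
        ENNReal.ofReal_one]
    have hnull : volume (Ω \ (U ∪ V)) = 0 := by
      have h := measure_inter_add_sdiff (μ := volume) Ω (hUcl.union hVcl).measurableSet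
      rw [htot, hΩ.volume_eq] at h
      exact (ENNReal.add_right_inj ENNReal.one_ne_top).1 (h.trans (add_zero 1).symm)
    exact sdiff_eq_empty.1 ((hopen.measure_eq_zero_iff volume).1 hnull)
  have hcon := isPreconnected_closed_iff.1 hΩ.convex.isPreconnected U V hUcl hVcl hcover
    (nonempty_of_measure_ne_zero (μ := volume) (by rw [hUvol]; exact hne hA))
    (nonempty_of_measure_ne_zero (μ := volume) (by rw [hVvol]; exact hne hA'))
  obtain ⟨x, hx, hxU, hxV⟩ := hcon
  exact Set.disjoint_left.1 hdisj ⟨hx, hxU⟩ ⟨hx, hxV⟩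

/-- Starting from `{a}`, the previous lemma adds one index at a time at cost `g`, until all indices
are reached. The bound holds for any two adapted choices; for `z = z'` it says that weights are
unique up to a constant. -/
lemma IsUnitDomain.weight_sub_le (hΩ : IsUnitDomain Ω R) {m : Fin N → ℝ}
    (hm : IsMassVector m) {z z' : Fin N → E3} (hz : z ∈ seedVectors N) (hz' : z' ∈ seedVectors N)
    {w w' : Fin N → ℝ} (hw : IsAdapted Ω m z w) (hw' : IsAdapted Ω m z' w') (a b : Fin N) :
    (w' a - w a) - (w' b - w b) ≤ N * (2 * R * ‖z - z'‖) := by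
  set g := 2 * R * ‖z - z'‖ with hg
  have hg0 : 0 ≤ g := by have := hΩ.radius_pos; positivity
  have key : ∀ k : ℕ, k < N → ∃ A : Finset (Fin N), A.card = k + 1 ∧
      ∀ i ∈ A, (w' a - w a) - (w' i - w i) ≤ k * g := by
    intro k
    induction k with
    | zero => exact fun _ => ⟨{a}, by simp, fun i hi => by simp [Finset.mem_singleton.1 hi]⟩
    | succ k ih =>
      intro hk
      obtain ⟨A, hcard, hA⟩ := ih (by lia)
      have hA1 : A.Nonempty := Finset.card_pos.1 (by lia)
      have hA2 : Aᶜ.Nonempty := Finset.card_pos.1 (by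
        rw [Finset.card_compl, Fintype.card_fin]; lia)
      obtain ⟨i, hi, j, hj, hij⟩ := hΩ.exists_weight_sub_le hm hz hz' hw hw' hA1 hA2
      refine ⟨insert j A, by rw [Finset.card_insert_of_notMem hj, hcard], fun l hl => ?_⟩
      push_cast
      rcases Finset.mem_insert.1 hl with rfl | hl
      · linarith [hA i hi]
      · linarith [hA l hl]
  have hN : 0 < N := a.pos
  obtain ⟨A, hcard, hA⟩ := key (N - 1) (by lia)
  have hAu : A = Finset.univ := by
    rw [← Finset.card_eq_iff_eq_univ, hcard, Fintype.card_fin]; lia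
  refine (hA b (hAu ▸ Finset.mem_univ b)).trans ?_
  gcongr
  lia

/-- The first moment of a Laguerre cell in `Ω`. -/
noncomputable def moment (Ω : Set E3) (z : Fin N → E3) (w : Fin N → ℝ) (i : Fin N) : E3 :=
  ∫ x in Ω ∩ cell z w i, x

lemma moment_eq_integral_indicator (Ω : Set E3) (z : Fin N → E3) (w : Fin N → ℝ) (i : Fin N) :
    moment Ω z w i = ∫ x in Ω, (cell z w i).indicator (fun x => x) x :=
  (setIntegral_indicator (isClosed_cell z w i).measurableSet).symm

/-- At a point that enters or leaves the cell, some affine difference changes sign, so it is bounded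
by its own variation: `2 * R * N * ‖z - z'‖` from the weights and `2 * R * ‖z - z'‖` from the seeds.
-/
lemma IsUnitDomain.abs_slab_le (hΩ : IsUnitDomain Ω R) {m : Fin N → ℝ}
    (hm : IsMassVector m) {z z' : Fin N → E3} (hz : z ∈ seedVectors N) (hz' : z' ∈ seedVectors N)
    {w w' : Fin N → ℝ} (hw : IsAdapted Ω m z w) (hw' : IsAdapted Ω m z' w') {i : Fin N} {x : E3}
    (hx : x ∈ Ω) (h : ¬ (x ∈ cell z w i ↔ x ∈ cell z' w' i)) :
    ∃ j, j ≠ i ∧ |inner ℝ x (z i - z j) + (w i - w j)| ≤ 2 * R * (N + 1) * ‖z - z'‖ := by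
  have h4 : ∀ k, |inner ℝ x (z k) - inner ℝ x (z' k)| ≤ R * ‖z - z'‖ := fun k => by
    rw [← inner_sub_right]
    exact (abs_real_inner_le_norm _ _).trans (mul_le_mul (hΩ.norm_le x hx)
      (norm_le_pi_norm (z - z') k) (norm_nonneg _) hΩ.radius_pos.le)
  have hW := hΩ.weight_sub_le hm hz hz' hw hw'
  have main : ∃ j, (0 ≤ inner ℝ x (z i - z j) + (w i - w j) ∧
      inner ℝ x (z' i - z' j) + (w' i - w' j) < 0) ∨
      (inner ℝ x (z i - z j) + (w i - w j) < 0 ∧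
      0 ≤ inner ℝ x (z' i - z' j) + (w' i - w' j)) := by
    simp only [inner_sub_right]
    by_cases h1 : x ∈ cell z w i
    · have h2 : x ∉ cell z' w' i := fun h2 => h (iff_of_true h1 h2)
      simp only [cell, mem_ofPred_eq, not_forall, not_le] at h2
      obtain ⟨j, hj⟩ := h2
      exact ⟨j, Or.inl ⟨by linarith [h1 j], by linarith⟩⟩
    · have h2 : x ∈ cell z' w' i := by tauto
      simp only [cell, mem_ofPred_eq, not_forall, not_le] at h1
      obtain ⟨j, hj⟩ := h1
      exact ⟨j, Or.inr ⟨by linarith, by linarith [h2 j]⟩⟩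
  obtain ⟨j, hj⟩ := main
  refine ⟨j, ?_, ?_⟩
  · rintro rfl
    simp at hj
  · have hi4 := abs_le.1 (h4 i)
    have hj4 := abs_le.1 (h4 j)
    have h5 := hW i j
    have h6 := hW j i
    simp only [inner_sub_right] at hj ⊢
    rw [abs_le]
    rcases hj with ⟨h7, h8⟩ | ⟨h7, h8⟩
    · constructor <;> nlinarith
    · constructor <;> nlinarith

/-- A Lipschitz constant for the moments of cells with seeds at mutual distance at least `ρ`. -/
noncomputable def momentConst (N : ℕ) (R ρ : ℝ) : ℝ :=
  N * (R * (slabConst R * (2 * R * (N + 1)) / ρ))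

lemma momentConst_nonneg (N : ℕ) {R ρ : ℝ} (hR : 0 < R) (hρ : 0 < ρ) :
    0 ≤ momentConst N R ρ := by
  have := slabConst_nonneg hR
  unfold momentConst; positivity

/-- The symmetric difference of the two cells is covered by one slab for each `j ≠ i`, of volume
proportional to `‖z - z'‖ / ρ`, and `‖x‖ ≤ R` there. Only `z` needs to be separated by `ρ`, which
makes the estimate usable at a fixed `z` against every nearby `z'`. -/
lemma IsUnitDomain.norm_moment_sub_le (hΩ : IsUnitDomain Ω R) {m : Fin N → ℝ}
    (hm : IsMassVector m) {z z' : Fin N → E3} (hz' : z' ∈ seedVectors N)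
    {w w' : Fin N → ℝ} (hw : IsAdapted Ω m z w) (hw' : IsAdapted Ω m z' w') {ρ : ℝ} (hρ : 0 < ρ)
    (hsep : ∀ i j, i ≠ j → ρ ≤ ‖z i - z j‖) (i : Fin N) :
    ‖moment Ω z w i - moment Ω z' w' i‖ ≤ momentConst N R ρ * ‖z - z'‖ := by
  have hz : z ∈ seedVectors N := fun i j hij h => by
    have := hsep i j hij
    rw [h, sub_self, norm_zero] at this
    linarith
  have hR := hΩ.radius_pos
  set ε := 2 * R * (N + 1) * ‖z - z'‖ with hε
  have hε0 : 0 ≤ ε := by positivity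
  set D : Fin N → Set E3 := fun j => {x | ‖x‖ ≤ R ∧ |inner ℝ x (z i - z j) + (w i - w j)| ≤ ε}
  have hDcl : ∀ j, MeasurableSet (D j) := fun j => by
    have h2 : Continuous fun x : E3 => |inner ℝ x (z i - z j) + (w i - w j)| := by fun_prop
    exact ((isClosed_le continuous_norm continuous_const).inter
      (isClosed_le h2 continuous_const)).measurableSet
  have hId : IntegrableOn (fun x : E3 => x) Ω := hΩ.integrableOn continuous_id
  have hind : ∀ (z : Fin N → E3) w, Integrable ((cell z w i).indicator fun x => x)
      (volume.restrict Ω) := fun z w => hId.integrable.indicator (isClosed_cell z w i).measurableSet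
  have hbd : ∀ᵐ x ∂volume.restrict Ω, ‖(cell z w i).indicator (fun x => x) x -
      (cell z' w' i).indicator (fun x => x) x‖ ≤
      ∑ j ∈ Finset.univ.erase i, (D j).indicator (fun _ => R) x := by
    filter_upwards [ae_restrict_mem hΩ.isOpen.measurableSet] with x hx
    have hnn : ∀ j ∈ Finset.univ.erase i, 0 ≤ (D j).indicator (fun _ => R) x := fun j _ =>
      indicator_nonneg (fun _ _ => hR.le) x
    by_cases hiff : x ∈ cell z w i ↔ x ∈ cell z' w' i
    · by_cases h1 : x ∈ cell z w i
      · rw [indicator_of_mem h1, indicator_of_mem (hiff.1 h1), sub_self, norm_zero]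
        exact Finset.sum_nonneg hnn
      · rw [indicator_of_notMem h1, indicator_of_notMem (fun h => h1 (hiff.2 h)), sub_self,
          norm_zero]
        exact Finset.sum_nonneg hnn
    · obtain ⟨j, hji, hj⟩ := hΩ.abs_slab_le hm hz hz' hw hw' hx hiff
      have hle : ‖(cell z w i).indicator (fun x => x) x -
          (cell z' w' i).indicator (fun x => x) x‖ ≤ ‖x‖ := by
        by_cases h1 : x ∈ cell z w i
        · have h2 : x ∉ cell z' w' i := fun h2 => hiff (iff_of_true h1 h2)
          simp [h1, h2]
        · have h2 : x ∈ cell z' w' i := by tauto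
          simp [h1, h2]
      refine hle.trans ((hΩ.norm_le x hx).trans ?_)
      have hxD : x ∈ D j := ⟨hΩ.norm_le x hx, hj⟩
      calc R = (D j).indicator (fun _ => R) x := by rw [indicator_of_mem hxD]
        _ ≤ _ := Finset.single_le_sum hnn (Finset.mem_erase.2 ⟨hji, Finset.mem_univ j⟩)
  have hDint : ∀ j, Integrable ((D j).indicator fun _ => R) (volume.restrict Ω) := fun j =>
    (hΩ.integrableOn continuous_const).integrable.indicator (hDcl j)
  rw [moment_eq_integral_indicator, moment_eq_integral_indicator, ← integral_sub (hind z w) (hind z' w')]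
  refine (norm_integral_le_of_norm_le (integrable_finsetSum _ fun j _ => hDint j) hbd).trans ?_
  rw [integral_finsetSum _ fun j _ => hDint j]
  have hterm : ∀ j ∈ Finset.univ.erase i, ∫ x in Ω, (D j).indicator (fun _ => R) x ≤
      R * (slabConst R * (2 * R * (N + 1)) / ρ) * ‖z - z'‖ := by
    intro j hj
    have hij : i ≠ j := (Finset.ne_of_mem_erase hj).symm
    rw [setIntegral_indicator (hDcl j), setIntegral_const, smul_eq_mul, mul_comm, mul_assoc]
    refine mul_le_mul_of_nonneg_left ?_ hR.le
    have h1 := (measure_mono (μ := volume) (inter_subset_right (s := Ω) (t := D j))).trans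
      (volume_slab_le hR (sub_ne_zero.2 (hz i j hij)) (w i - w j) hε0)
    have hs := slabConst_nonneg hR
    have h2 : volume.real (Ω ∩ D j) ≤ slabConst R * ε / ‖z i - z j‖ :=
      ENNReal.toReal_le_of_le_ofReal (by positivity) h1
    refine h2.trans ?_
    calc slabConst R * ε / ‖z i - z j‖ ≤ slabConst R * ε / ρ := by
          gcongr; exact hsep i j hij
      _ = _ := by rw [hε]; ring
  refine (Finset.sum_le_card_nsmul _ _ _ hterm).trans ?_
  have hs := slabConst_nonneg hR
  have hcard : ((Finset.univ.erase i).card : ℝ) ≤ N := by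
    exact_mod_cast (Finset.card_le_univ _).trans (Fintype.card_fin N).le
  rw [nsmul_eq_mul, momentConst, mul_assoc (N : ℝ)]
  exact mul_le_mul_of_nonneg_right hcard (by positivity)

lemma IsUnitDomain.norm_moment_le (hΩ : IsUnitDomain Ω R) (z : Fin N → E3) (w : Fin N → ℝ)
    (i : Fin N) : ‖moment Ω z w i‖ ≤ R := by
  rw [moment_eq_integral_indicator]
  refine hΩ.norm_integral_le fun x hx => ?_
  exact (norm_indicator_le_norm_self (fun x : E3 => x) x).trans (hΩ.norm_le x hx)

open Classical in
/-- Some choice of adapted weights. -/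
noncomputable def weights (Ω : Set E3) (m : Fin N → ℝ) (z : Fin N → E3) : Fin N → ℝ :=
  if h : ∃ w, IsAdapted Ω m z w then h.choose else 0

lemma IsUnitDomain.isAdapted_weights (hΩ : IsUnitDomain Ω R) {m : Fin N → ℝ}
    (hm : IsMassVector m) {z : Fin N → E3} (hz : z ∈ seedVectors N) :
    IsAdapted Ω m z (weights Ω m z) := by
  have h := hΩ.exists_isAdapted hm hz
  rw [weights, dif_pos h]
  exact h.choose_spec

/-- The centroid of the `i`-th optimal cell for the seeds `z` with masses `m`. -/
noncomputable def centroid (Ω : Set E3) (m : Fin N → ℝ) (z : Fin N → E3) (i : Fin N) : E3 :=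
  (m i)⁻¹ • moment Ω z (weights Ω m z) i

lemma smul_centroid {m : Fin N → ℝ} (hm : IsMassVector m) (Ω : Set E3) (z : Fin N → E3)
    (i : Fin N) : m i • centroid Ω m z i = moment Ω z (weights Ω m z) i := by
  rw [centroid, smul_smul, mul_inv_cancel₀ (hm.1 i).ne', one_smul]

lemma IsUnitDomain.norm_centroid_sub_le (hΩ : IsUnitDomain Ω R) {m : Fin N → ℝ}
    (hm : IsMassVector m) {z z' : Fin N → E3} (hz' : z' ∈ seedVectors N) {ρ : ℝ} (hρ : 0 < ρ)
    (hsep : ∀ i j, i ≠ j → ρ ≤ ‖z i - z j‖) (i : Fin N) :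
    ‖centroid Ω m z i - centroid Ω m z' i‖ ≤ (m i)⁻¹ * momentConst N R ρ * ‖z - z'‖ := by
  have hz : z ∈ seedVectors N := fun i j hij h => by
    have := hsep i j hij
    rw [h, sub_self, norm_zero] at this
    linarith
  have hmi := hm.1 i
  rw [centroid, centroid, ← smul_sub, norm_smul, Real.norm_of_nonneg (inv_nonneg.2 hmi.le),
    mul_assoc]
  gcongr
  exact hΩ.norm_moment_sub_le hm hz' (hΩ.isAdapted_weights hm hz) (hΩ.isAdapted_weights hm hz')
    hρ hsep i

lemma IsUnitDomain.norm_centroid_le (hΩ : IsUnitDomain Ω R) {m : Fin N → ℝ}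
    (hm : IsMassVector m) (z : Fin N → E3) (i : Fin N) :
    ‖centroid Ω m z i‖ ≤ (m i)⁻¹ * R := by
  have hmi := hm.1 i
  rw [centroid, norm_smul, Real.norm_of_nonneg (inv_nonneg.2 hmi.le)]
  gcongr
  exact hΩ.norm_moment_le _ _ _

lemma exists_separation {z : Fin N → E3} (hz : z ∈ seedVectors N) :
    ∃ ρ > 0, ∀ i j, i ≠ j → ρ ≤ ‖z i - z j‖ := by
  by_cases h : (Finset.univ.offDiag : Finset (Fin N × Fin N)).Nonempty
  · obtain ⟨p, hp, hmin⟩ := Finset.exists_min_image _ (fun p => ‖z p.1 - z p.2‖) h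
    refine ⟨‖z p.1 - z p.2‖, norm_pos_iff.2 (sub_ne_zero.2 (hz _ _ ?_)), fun i j hij => ?_⟩
    · exact (Finset.mem_offDiag.1 hp).2.2
    · exact hmin (i, j) (Finset.mem_offDiag.2 ⟨Finset.mem_univ _, Finset.mem_univ _, hij⟩)
  · refine ⟨1, one_pos, fun i j hij => (h ⟨(i, j), ?_⟩).elim⟩
    exact Finset.mem_offDiag.2 ⟨Finset.mem_univ _, Finset.mem_univ _, hij⟩

lemma IsUnitDomain.continuousOn_centroid (hΩ : IsUnitDomain Ω R) {m : Fin N → ℝ}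
    (hm : IsMassVector m) (i : Fin N) :
    ContinuousOn (fun z => centroid Ω m z i) (seedVectors N) := by
  intro z hz
  obtain ⟨ρ, hρ, hsep⟩ := exists_separation hz
  rw [ContinuousWithinAt, tendsto_iff_norm_sub_tendsto_zero]
  have hlim : Tendsto (fun z' => (m i)⁻¹ * momentConst N R ρ * ‖z - z'‖) (𝓝[seedVectors N] z)
      (𝓝 0) := by
    have : Continuous fun z' => (m i)⁻¹ * momentConst N R ρ * ‖z - z'‖ := by fun_prop
    simpa using (this.tendsto z).mono_left nhdsWithin_le_nhds
  refine squeeze_zero' (Eventually.of_forall fun _ => norm_nonneg _) ?_ hlim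
  filter_upwards [self_mem_nhdsWithin] with z' hz'
  rw [norm_sub_rev]
  exact hΩ.norm_centroid_sub_le hm hz' hρ hsep i

end Stability

/-! ### Integration against discrete measures -/

section DiscreteMeasure

variable {N : ℕ}

lemma discreteMeasure_eq_sum (m : Fin N → ℝ) (z : Fin N → E3) :
    discreteMeasure m z = Measure.sum fun i => ENNReal.ofReal (m i) • Measure.dirac (z i) :=
  (Measure.sum_fintype _).symm

lemma ae_discreteMeasure (m : Fin N → ℝ) (z : Fin N → E3) :
    ∀ᵐ y ∂discreteMeasure m z, ∃ i, y = z i := by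
  rw [discreteMeasure_eq_sum, ae_iff, Measure.sum_apply_eq_zero]
  intro i
  have : ∀ᵐ y ∂(Measure.dirac (z i)), ∃ i, y = z i := by
    rw [ae_dirac_eq]; exact ⟨i, rfl⟩
  exact Measure.ae_smul_measure this _

lemma integrable_discreteMeasure (m : Fin N → ℝ) (z : Fin N → E3) {F : Type*}
    [NormedAddCommGroup F] (f : E3 → F) : Integrable f (discreteMeasure m z) := by
  refine integrable_finsetSum_measure.2 fun i _ => ?_
  exact (integrable_dirac (by simp)).smul_measure ENNReal.ofReal_ne_top

lemma integral_discreteMeasure {m : Fin N → ℝ} (hm : ∀ i, 0 ≤ m i) (z : Fin N → E3) {F : Type*}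
    [NormedAddCommGroup F] [NormedSpace ℝ F] [CompleteSpace F] (f : E3 → F) :
    ∫ y, f y ∂discreteMeasure m z = ∑ i, m i • f (z i) := by
  rw [discreteMeasure, integral_finsetSum_measure fun i _ =>
    (integrable_dirac (by simp)).smul_measure ENNReal.ofReal_ne_top]
  simp_rw [integral_smul_measure, integral_dirac]
  exact Finset.sum_congr rfl fun i _ => by rw [ENNReal.toReal_ofReal (hm i)]

end DiscreteMeasure

/-! ### The Brenier map of a discrete measure -/

section Brenier

variable {N : ℕ} {Ω : Set E3} {R : ℝ} {m : Fin N → ℝ} {z : Fin N → E3} {w : Fin N → ℝ}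

lemma IsUnitDomain.isFiniteMeasure (hΩ : IsUnitDomain Ω R) :
    IsFiniteMeasure (volume.restrict Ω) :=
  ⟨by rw [Measure.restrict_apply_univ, hΩ.volume_eq]; simp⟩

lemma IsUnitDomain.ae_cell (hΩ : IsUnitDomain Ω R) [NeZero N] (hz : z ∈ seedVectors N)
    (w : Fin N → ℝ) :
    ∀ᵐ x ∂volume.restrict Ω, ∃ i, x ∈ cell z w i ∧ ∀ j, x ∈ cell z w j → j = i := by
  have h : ∀ i j, i ≠ j → ∀ᵐ x ∂volume.restrict Ω, ¬ (x ∈ cell z w i ∧ x ∈ cell z w j) := by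
    intro i j hij
    rw [ae_restrict_iff' hΩ.isOpen.measurableSet]
    filter_upwards [measure_eq_zero_iff_ae_notMem.1 (hΩ.aedisjoint_cell (w := w) (hz i j hij))]
      with x hx h1 h2 using hx ⟨h1, h2⟩
  simp only [← ae_all_iff] at h
  filter_upwards [h] with x hx
  obtain ⟨i, hi⟩ := exists_mem_cell z w x
  exact ⟨i, hi, fun j hj => by_contra fun hji => hx j i hji ⟨hj, hi⟩⟩

lemma IsUnitDomain.restrict_eq_sum (hΩ : IsUnitDomain Ω R) [NeZero N] (hz : z ∈ seedVectors N)
    (w : Fin N → ℝ) :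
    volume.restrict Ω = ∑ i, volume.restrict (Ω ∩ cell z w i) := by
  have h := Measure.restrict_iUnion_ae (hΩ.pairwise_aedisjoint hz w)
    fun i => (hΩ.measurableSet_cell z w i).nullMeasurableSet
  rw [Measure.sum_fintype] at h
  rw [← h, ← inter_iUnion]
  congr 1
  exact (inter_eq_left.2 fun x _ => mem_iUnion.2 (exists_mem_cell z w x)).symm

/-- `S` takes the value `z i` almost everywhere on the `i`-th cell. -/
def IsCellMap (Ω : Set E3) (z : Fin N → E3) (w : Fin N → ℝ) (S : E3 → E3) : Prop :=
  ∀ᵐ x ∂volume.restrict Ω, ∀ i, x ∈ cell z w i → S x = z i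

lemma IsCellMap.ae_eq {S : E3 → E3} (hΩ : IsUnitDomain Ω R) (hS : IsCellMap Ω z w S)
    (i : Fin N) : ∀ᵐ x ∂volume.restrict (Ω ∩ cell z w i), S x = z i := by
  have h := hS
  rw [IsCellMap, ae_restrict_iff' hΩ.isOpen.measurableSet] at h
  rw [ae_restrict_iff' (hΩ.measurableSet_cell z w i)]
  filter_upwards [h] with x hx hxi using hx hxi.1 i hxi.2

lemma IsCellMap.map_eq [NeZero N] {S : E3 → E3} (hΩ : IsUnitDomain Ω R) (hz : z ∈ seedVectors N)
    (hw : IsAdapted Ω m z w) (hS : IsCellMap Ω z w S) (hmeas : Measurable S) :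
    (volume.restrict Ω).map S = discreteMeasure m z := by
  rw [hΩ.restrict_eq_sum hz w, Measure.map_finset_sum hmeas.aemeasurable, discreteMeasure]
  refine Finset.sum_congr rfl fun i _ => ?_
  rw [Measure.map_congr (hS.ae_eq hΩ i), Measure.map_const, Measure.restrict_apply_univ, hw i]

lemma IsCellMap.integral_eq [NeZero N] {S : E3 → E3} (hΩ : IsUnitDomain Ω R)
    (hz : z ∈ seedVectors N) (hS : IsCellMap Ω z w S) {F : Type*} [NormedAddCommGroup F]
    [NormedSpace ℝ F] {f : E3 → E3 → F} (hf : ∀ i, Continuous fun x => f x (z i)) :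
    ∫ x in Ω, f x (S x) = ∑ i, ∫ x in Ω ∩ cell z w i, f x (z i) := by
  have hae : ∀ i, (fun x => f x (S x)) =ᵐ[volume.restrict (Ω ∩ cell z w i)]
      fun x => f x (z i) := fun i => by
    filter_upwards [hS.ae_eq hΩ i] with x hx
    rw [hx]
  rw [hΩ.restrict_eq_sum hz w, integral_finsetSum_measure fun i _ =>
    ((hΩ.integrableOn (hf i)).mono_set inter_subset_left).congr (hae i).symm]
  exact Finset.sum_congr rfl fun i _ => integral_congr_ae (hae i)

/-- The function which takes the value `w i` at the seed `z i`. -/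
noncomputable def seedWeight (z : Fin N → E3) (w : Fin N → ℝ) (y : E3) : ℝ :=
  ∑ i, ({z i} : Set E3).indicator (fun _ => w i) y

lemma seedWeight_apply (hz : z ∈ seedVectors N) (w : Fin N → ℝ) (i : Fin N) :
    seedWeight z w (z i) = w i := by
  rw [seedWeight, Finset.sum_eq_single i]
  · simp
  · intro j _ hj
    have hmem : z i ∉ ({z j} : Set E3) := hz i j hj.symm
    rw [indicator_of_notMem hmem]
  · simp

lemma measurable_seedWeight (z : Fin N → E3) (w : Fin N → ℝ) : Measurable (seedWeight z w) :=
  Finset.measurable_fun_sum _ fun i _ => measurable_const.indicator (measurableSet_singleton (z i))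

/-- The defect in the duality inequality for the map `S`. -/
noncomputable def dualityGap (z : Fin N → E3) (w : Fin N → ℝ) (S : E3 → E3) (x : E3) : ℝ :=
  envelope z w x - inner ℝ x (S x) - seedWeight z w (S x)

/-- The quadratic transport cost predicted by the dual problem. -/
noncomputable def dualCost (Ω : Set E3) (m : Fin N → ℝ) (z : Fin N → E3) (w : Fin N → ℝ) : ℝ :=
  (∫ x in Ω, (‖x‖ ^ 2 - 2 * envelope z w x)) +
    ∫ y, (‖y‖ ^ 2 + 2 * seedWeight z w y) ∂discreteMeasure m z

lemma IsTransportMap.ae_exists_eq {S : E3 → E3} (hS : IsTransportMap Ω (discreteMeasure m z) S) :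
    ∀ᵐ x ∂volume.restrict Ω, ∃ i, S x = z i :=
  ae_of_ae_map hS.1.aemeasurable (hS.2 ▸ ae_discreteMeasure m z)

lemma IsTransportMap.dualityGap_nonneg {S : E3 → E3} (hz : z ∈ seedVectors N)
    (hS : IsTransportMap Ω (discreteMeasure m z) S) (w : Fin N → ℝ) :
    0 ≤ᵐ[volume.restrict Ω] dualityGap z w S := by
  filter_upwards [hS.ae_exists_eq] with x ⟨i, hi⟩
  rw [dualityGap, hi, seedWeight_apply hz, Pi.zero_apply]
  linarith [le_envelope z w x i]

lemma IsTransportMap.integrable_inner {S : E3 → E3} (hΩ : IsUnitDomain Ω R)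
    (hS : IsTransportMap Ω (discreteMeasure m z) S) :
    Integrable (fun x => inner ℝ x (S x)) (volume.restrict Ω) := by
  have := hΩ.isFiniteMeasure
  refine Integrable.of_bound (C := R * ‖z‖)
    (measurable_id.inner hS.1).aestronglyMeasurable ?_
  filter_upwards [hS.ae_exists_eq, ae_restrict_mem hΩ.isOpen.measurableSet] with x ⟨i, hi⟩ hx
  rw [hi]
  exact (abs_real_inner_le_norm _ _).trans (mul_le_mul (hΩ.norm_le x hx)
    (norm_le_pi_norm z i) (norm_nonneg _) hΩ.radius_pos.le)

lemma IsTransportMap.integrable_comp {S : E3 → E3}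
    (hS : IsTransportMap Ω (discreteMeasure m z) S) {f : E3 → ℝ} (hf : Measurable f) :
    Integrable (fun x => f (S x)) (volume.restrict Ω) := by
  have h := integrable_discreteMeasure m z f
  rw [← hS.2] at h
  exact (integrable_map_measure hf.aestronglyMeasurable hS.1.aemeasurable).1 h

lemma IsTransportMap.integrable_dualityGap [NeZero N] {S : E3 → E3} (hΩ : IsUnitDomain Ω R)
    (hS : IsTransportMap Ω (discreteMeasure m z) S) (w : Fin N → ℝ) :
    Integrable (dualityGap z w S) (volume.restrict Ω) :=
  ((hΩ.integrableOn_envelope z w).integrable.sub (hS.integrable_inner hΩ)).sub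
    (hS.integrable_comp (measurable_seedWeight z w))

/-- Expanding the square, every term except the duality gap depends on `S` only through its fixed
pushforward. Minimising the cost is therefore minimising the integral of a nonnegative gap. -/
lemma IsTransportMap.integral_sq [NeZero N] {S : E3 → E3} (hΩ : IsUnitDomain Ω R)
    (hS : IsTransportMap Ω (discreteMeasure m z) S) (w : Fin N → ℝ) :
    Integrable (fun x => ‖x - S x‖ ^ 2) (volume.restrict Ω) ∧
    ∫ x in Ω, ‖x - S x‖ ^ 2 = dualCost Ω m z w + 2 * ∫ x in Ω, dualityGap z w S x := by
  have hq : Measurable fun y : E3 => ‖y‖ ^ 2 + 2 * seedWeight z w y :=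
    (measurable_norm.pow_const 2).add ((measurable_seedWeight z w).const_mul 2)
  have h1 : Integrable (fun x => ‖x‖ ^ 2 - 2 * envelope z w x) (volume.restrict Ω) :=
    hΩ.integrableOn (by have := (lipschitzWith_envelope z w).continuous; fun_prop)
  have h2 := hS.integrable_comp hq
  have h3 := (hS.integrable_dualityGap hΩ w).const_mul 2
  have hpt : (fun x => ‖x - S x‖ ^ 2) = fun x => (‖x‖ ^ 2 - 2 * envelope z w x) +
      (‖S x‖ ^ 2 + 2 * seedWeight z w (S x)) + 2 * dualityGap z w S x := by
    funext x
    rw [norm_sub_sq_real, dualityGap]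
    ring
  have h12 : Integrable (fun x => (‖x‖ ^ 2 - 2 * envelope z w x) +
      (‖S x‖ ^ 2 + 2 * seedWeight z w (S x))) (volume.restrict Ω) := h1.add h2
  rw [hpt]
  refine ⟨h12.add h3, ?_⟩
  rw [integral_add h12 h3, integral_add h1 h2, integral_const_mul, dualCost, ← hS.2,
    integral_map hS.1.aemeasurable hq.aestronglyMeasurable]

lemma IsTransportMap.lintegral_edist_sq [NeZero N] {S : E3 → E3} (hΩ : IsUnitDomain Ω R)
    (hS : IsTransportMap Ω (discreteMeasure m z) S) (w : Fin N → ℝ) :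
    ∫⁻ x in Ω, edist x (S x) ^ 2 =
      ENNReal.ofReal (dualCost Ω m z w + 2 * ∫ x in Ω, dualityGap z w S x) := by
  obtain ⟨hint, heq⟩ := hS.integral_sq hΩ w
  rw [← heq, ofReal_integral_eq_lintegral_ofReal hint (ae_of_all _ fun x => by positivity)]
  refine lintegral_congr fun x => ?_
  rw [edist_dist, dist_eq_norm, ENNReal.ofReal_pow (norm_nonneg _)]

lemma IsCellMap.integral_dualityGap [NeZero N] {S : E3 → E3} (hz : z ∈ seedVectors N)
    (hS : IsCellMap Ω z w S) : ∫ x in Ω, dualityGap z w S x = 0 := by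
  refine integral_eq_zero_of_ae ?_
  filter_upwards [hS] with x hx
  obtain ⟨i, hi⟩ := exists_mem_cell z w x
  rw [dualityGap, hx i hi, seedWeight_apply hz, envelope_eq_of_mem_cell hi, Pi.zero_apply]
  ring

lemma IsCellMap.isOptimalTransportMap [NeZero N] {S : E3 → E3} (hΩ : IsUnitDomain Ω R)
    (hz : z ∈ seedVectors N) (hw : IsAdapted Ω m z w) (hS : IsCellMap Ω z w S)
    (hmeas : Measurable S) : IsOptimalTransportMap Ω (discreteMeasure m z) S := by
  have hT : IsTransportMap Ω (discreteMeasure m z) S := ⟨hmeas, hS.map_eq hΩ hz hw hmeas⟩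
  refine ⟨hT, fun S' hS' => ?_⟩
  rw [hT.lintegral_edist_sq hΩ w, hS'.lintegral_edist_sq hΩ w, hS.integral_dualityGap hz]
  refine ENNReal.ofReal_le_ofReal ?_
  have := integral_nonneg_of_ae (hS'.dualityGap_nonneg hz w)
  linarith

/-- Comparison with the cell map `S₀`, whose gap has integral zero, forces the gap of `S` to vanish
almost everywhere, which places `x` in the cell of the seed `S x`. This is the uniqueness half of
Brenier's theorem in the discrete case. -/
lemma IsOptimalTransportMap.isCellMap [NeZero N] {S S₀ : E3 → E3} (hΩ : IsUnitDomain Ω R)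
    (hz : z ∈ seedVectors N) (hw : IsAdapted Ω m z w) (hS₀ : IsCellMap Ω z w S₀)
    (hmeas : Measurable S₀) (hS : IsOptimalTransportMap Ω (discreteMeasure m z) S) :
    IsCellMap Ω z w S := by
  have hT : IsTransportMap Ω (discreteMeasure m z) S₀ := ⟨hmeas, hS₀.map_eq hΩ hz hw hmeas⟩
  have hle := hS.2 S₀ hT
  rw [hT.lintegral_edist_sq hΩ w, hS.1.lintegral_edist_sq hΩ w, hS₀.integral_dualityGap hz,
    mul_zero, add_zero] at hle
  have hA : 0 ≤ dualCost Ω m z w := by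
    have h := (hT.integral_sq hΩ w).2
    rw [hS₀.integral_dualityGap hz, mul_zero, add_zero] at h
    rw [← h]
    exact integral_nonneg fun x => by positivity
  rw [ENNReal.ofReal_le_ofReal_iff hA] at hle
  have hnn := hS.1.dualityGap_nonneg hz w
  have h0 : ∫ x in Ω, dualityGap z w S x = 0 :=
    le_antisymm (by linarith) (integral_nonneg_of_ae hnn)
  rw [integral_eq_zero_iff_of_nonneg_ae hnn (hS.1.integrable_dualityGap hΩ w)] at h0
  filter_upwards [h0, hS.1.ae_exists_eq, hΩ.ae_cell hz w] with x hx ⟨i, hi⟩ ⟨k, hk, huniq⟩ j hj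
  rw [dualityGap, hi, seedWeight_apply hz, Pi.zero_apply] at hx
  have hxi : x ∈ cell z w i := mem_cell_of_envelope_le (by linarith)
  rw [hi, huniq i hxi, huniq j hj]

lemma measurable_gradient (f : E3 → ℝ) : Measurable (∇ f) :=
  (InnerProductSpace.toDual ℝ E3).symm.continuous.measurable.comp (measurable_fderiv ℝ f)

/-- If a single affine function attains the maximum at `x`, it still does so in a neighbourhood,
where the envelope is affine. -/
lemma gradient_envelope_sub_const {x : E3} {i : Fin N} (hi : x ∈ cell z w i)
    (huniq : ∀ j, x ∈ cell z w j → j = i) (c : ℝ) :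
    ∇ (fun x => envelope z w x - c) x = z i := by
  have hlt : ∀ j, j ≠ i → inner ℝ x (z j) + w j < inner ℝ x (z i) + w i := by
    intro j hj
    refine lt_of_le_of_ne (hi j) fun heq => hj (huniq j fun k => ?_)
    rw [heq]; exact hi k
  have hev : ∀ᶠ y in 𝓝 x, y ∈ cell z w i := by
    have : ∀ᶠ y in 𝓝 x, ∀ j, j ≠ i → inner ℝ y (z j) + w j < inner ℝ y (z i) + w i := by
      rw [eventually_all]; intro j
      by_cases hj : j = i
      · exact Eventually.of_forall fun y h => (h hj).elim
      · have hc1 : Continuous fun y : E3 => inner ℝ y (z j) + w j := by fun_prop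
        have hc2 : Continuous fun y : E3 => inner ℝ y (z i) + w i := by fun_prop
        filter_upwards [(hc1.tendsto x).eventually_lt (hc2.tendsto x) (hlt j hj)] with y hy _ using hy
    filter_upwards [this] with y hy j
    by_cases hj : j = i
    · rw [hj]
    · exact (hy j hj).le
  have hgrad : HasGradientAt (fun y => inner ℝ (z i) y + (w i - c)) (z i) x := by
    rw [hasGradientAt_iff_hasFDerivAt]
    exact (((InnerProductSpace.toDual ℝ E3) (z i)).hasFDerivAt (x := x)).add_const (w i - c)
  refine (hgrad.congr_of_eventuallyEq ?_).gradient
  filter_upwards [hev] with y hy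
  rw [envelope_eq_of_mem_cell hy, real_inner_comm]
  ring

lemma isCellMap_gradient [NeZero N] (hΩ : IsUnitDomain Ω R) (hz : z ∈ seedVectors N)
    (w : Fin N → ℝ) (c : ℝ) : IsCellMap Ω z w (∇ fun x => envelope z w x - c) := by
  filter_upwards [hΩ.ae_cell hz w] with x ⟨i, hi, huniq⟩ j hj
  rw [huniq j hj, gradient_envelope_sub_const hi huniq]

/-- Rademacher's theorem and integration by parts of directional derivatives, applied after pairing
with each fixed vector `v`. -/
lemma isWeakGradient_of_lipschitzWith {K : NNReal} {f : E3 → ℝ} (hf : LipschitzWith K f)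
    (Ω : Set E3) : IsWeakGradient Ω f (∇ f) := by
  intro φ hφ hcs hsupp
  have hφc : Continuous φ := hφ.continuous
  have hgφ : Continuous (∇ φ) :=
    (InnerProductSpace.toDual ℝ E3).symm.continuous.comp (hφ.continuous_fderiv (by simp))
  have hφ0 : ∀ x, x ∉ Ω → φ x = 0 := fun x hx => image_eq_zero_of_notMem_tsupport fun h => hx (hsupp h)
  have hgφ0 : ∀ x, x ∉ tsupport φ → ∇ φ x = 0 := fun x hx => by
    rw [gradient, notMem_tsupport_iff_eventuallyEq.1 hx |>.fderiv_eq]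
    simp
  have hcsg : HasCompactSupport (∇ φ) := HasCompactSupport.intro hcs.isCompact hgφ0
  have hI1 : Integrable (fun x => f x • ∇ φ x) :=
    (hf.continuous.smul hgφ).integrable_of_hasCompactSupport hcsg.smul_left
  have hbound : ∀ x, ‖∇ f x‖ ≤ K := fun x => by
    rw [gradient, LinearIsometryEquiv.norm_map]
    exact norm_fderiv_le_of_lipschitz ℝ hf
  have hI2 : Integrable (fun x => φ x • ∇ f x) := by
    refine ((hφc.integrable_of_hasCompactSupport hcs).norm.mul_const (K : ℝ)).mono'
      (hφc.measurable.smul (measurable_gradient f)).aestronglyMeasurable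
      (ae_of_all _ fun x => ?_)
    rw [norm_smul]
    exact mul_le_mul_of_nonneg_left (hbound x) (norm_nonneg _)
  rw [setIntegral_eq_integral_of_forall_compl_eq_zero fun x hx => by
      rw [hgφ0 x fun h => hx (hsupp h), smul_zero],
    setIntegral_eq_integral_of_forall_compl_eq_zero fun x hx => by rw [hφ0 x hx, zero_smul]]
  refine ext_inner_left ℝ fun v => ?_
  rw [inner_neg_right, ← integral_inner hI1, ← integral_inner hI2]
  obtain ⟨D, hD⟩ := hφ.lipschitzWith_of_hasCompactSupport hcs (by simp)
  have key := hf.integral_lineDeriv_mul_eq (μ := volume) hD hcs v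
  have e1 : ∫ x, inner ℝ v (φ x • ∇ f x) = ∫ x, lineDeriv ℝ f x v * φ x := by
    refine integral_congr_ae ?_
    filter_upwards [hf.ae_differentiableAt (μ := volume)] with x hx
    rw [hx.lineDeriv_eq_fderiv, ← inner_gradient_left, inner_smul_right, real_inner_comm, mul_comm]
  have e2 : ∫ x, inner ℝ v (f x • ∇ φ x) = -∫ x, lineDeriv ℝ φ x (-v) * f x := by
    rw [← integral_neg]
    refine integral_congr_ae (ae_of_all _ fun x => ?_)
    have hx : DifferentiableAt ℝ φ x := hφ.differentiable (by simp) x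
    simp only
    rw [hx.lineDeriv_eq_fderiv, ← inner_gradient_left, inner_smul_right, real_inner_comm,
      inner_neg_right]
    ring
  rw [e1, e2, key]

lemma IsUnitDomain.isBrenierPotential [NeZero N] (hΩ : IsUnitDomain Ω R)
    (hz : z ∈ seedVectors N) (hw : IsAdapted Ω m z w) :
    IsBrenierPotential Ω (discreteMeasure m z)
      fun x => envelope z w x - ∫ y in Ω, envelope z w y := by
  have := hΩ.isFiniteMeasure
  set c := ∫ y in Ω, envelope z w y
  have hlip : LipschitzWith ‖z‖₊ fun x => envelope z w x - c :=
    LipschitzWith.of_dist_le_mul fun x y => by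
      rw [Real.dist_eq, sub_sub_sub_cancel_right, ← Real.dist_eq]
      exact (lipschitzWith_envelope z w).dist_le_mul x y
  refine ⟨?_, ⟨?_, ∇ (fun x => envelope z w x - c), ?_, isWeakGradient_of_lipschitzWith hlip Ω⟩, ?_, ?_⟩
  · exact (convexOn_envelope z w hΩ.convex).sub (concaveOn_const c hΩ.convex)
  · obtain ⟨C, hC⟩ := (isCompact_closedBall (0 : E3) R).exists_bound_of_continuousOn
      hlip.continuous.continuousOn
    refine MemLp.of_bound hlip.continuous.aestronglyMeasurable C ?_
    filter_upwards [ae_restrict_mem hΩ.isOpen.measurableSet] with x hx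
    exact hC x (by simpa using hΩ.norm_le x hx)
  · refine MemLp.of_bound (measurable_gradient _).aestronglyMeasurable ‖z‖ ?_
    filter_upwards [isCellMap_gradient hΩ hz w c] with x hx
    obtain ⟨i, hi⟩ := exists_mem_cell z w x
    rw [hx i hi]
    exact norm_le_pi_norm z i
  · rw [integral_sub (hΩ.integrableOn_envelope z w) (hΩ.integrableOn continuous_const)]
    simp [hΩ.real_eq, c]
  · exact (isCellMap_gradient hΩ hz w c).isOptimalTransportMap hΩ hz hw (measurable_gradient _)

/-- `brenier` is an arbitrary choice of potential, but the envelope shows that one exists, and the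
gradient of any of them is optimal, hence a cell map. -/
lemma IsUnitDomain.isCellMap_brenier [NeZero N] (hΩ : IsUnitDomain Ω R)
    (hz : z ∈ seedVectors N) (hw : IsAdapted Ω m z w) :
    IsCellMap Ω z w (∇ (brenier Ω (discreteMeasure m z))) := by
  have h : ∃ Φ, IsBrenierPotential Ω (discreteMeasure m z) Φ := ⟨_, hΩ.isBrenierPotential hz hw⟩
  rw [brenier, dif_pos h]
  exact h.choose_spec.optimal.isCellMap hΩ hz hw (isCellMap_gradient hΩ hz w 0)
    (measurable_gradient _)

lemma IsUnitDomain.integral_brenier (hΩ : IsUnitDomain Ω R) (hm : IsMassVector m)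
    (hz : z ∈ seedVectors N) {F : Type*} [NormedAddCommGroup F]
    [NormedSpace ℝ F] {f : E3 → E3 → F} (hf : ∀ i, Continuous fun x => f x (z i)) :
    ∫ x in Ω, f x (∇ (brenier Ω (discreteMeasure m z)) x) =
      ∑ i, ∫ x in Ω ∩ cell z (weights Ω m z) i, f x (z i) := by
  have := hm.neZero
  exact (hΩ.isCellMap_brenier hz (hΩ.isAdapted_weights hm hz)).integral_eq hΩ hz hf

end Brenier

/-! ### Global solutions of a linear equation with bounded perturbation -/

section LinearPlusBounded

/-- A bounded Lipschitz perturbation of a linear vector field has solutions on every `[0, T]`. -/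
lemma exists_hasDerivWithinAt_linear_add {E : Type*} [NormedAddCommGroup E] [NormedSpace ℝ E]
    [CompleteSpace E] (A : E →L[ℝ] E) {b : E → E} {K M : NNReal} (hb : LipschitzWith K b)
    (hM : ∀ x, ‖b x‖ ≤ M) {T : ℝ} (hT : 0 ≤ T) (x₀ : E) :
    ∃ z : ℝ → E, z 0 = x₀ ∧
      ∀ t ∈ Icc 0 T, HasDerivWithinAt z (A (z t) + b (z t)) (Icc 0 T) t := by
  let _ : NormedAlgebra ℚ (E →L[ℝ] E) := NormedAlgebra.restrictScalars ℚ ℝ _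
  let e : ℝ → E →L[ℝ] E := fun t => NormedSpace.exp (t • A)
  have he : ∀ t, HasDerivAt e (A * e t) t := fun t => hasDerivAt_exp_smul_const' A t
  have hec : Continuous e := continuous_iff_continuousAt.2 fun t => (he t).continuousAt
  have hinv : ∀ t x, e t (e (-t) x) = x := by
    intro t x
    have h : e t * e (-t) = 1 := by
      simp only [e]
      rw [← NormedSpace.exp_add_of_commute (by
        rw [neg_smul]; exact (Commute.refl _).neg_right), ← add_smul, add_neg_cancel, zero_smul,
        NormedSpace.exp_zero]
    exact DFunLike.congr_fun h x
  obtain ⟨C, hC⟩ := (isCompact_Icc (a := -T) (b := T)).exists_bound_of_continuousOn hec.continuousOn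
  have hC0 : 0 ≤ C := (norm_nonneg _).trans (hC 0 ⟨by linarith, hT⟩)
  lift C to NNReal using hC0
  lift T to NNReal using hT
  -- Variation of constants: with `z t = e t (y t)` the equation becomes `y' = f t y`. Since `f` is
  -- bounded by `C * M`, the Picard–Lindelöf ball of radius `C * M * T` serves the whole of `[0,
  -- T]`.
  let f : ℝ → E → E := fun t y => e (-t) (b (e t y))
  have hPL : IsPicardLindelof f (tmin := 0) (tmax := T) ⟨0, le_rfl, T.2⟩ x₀ (C * M * T) 0 (C * M)
      (C * (K * C)) := by
    refine ⟨fun t ht => LipschitzWith.lipschitzOnWith ?_, fun x _ => Continuous.continuousOn ?_,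
      fun t ht x _ => ?_, ?_⟩
    · have h1 : LipschitzWith C (e t) := (e t).lipschitz.weaken
        (by exact_mod_cast hC t ⟨by linarith [ht.1, T.2], ht.2⟩)
      have h2 : LipschitzWith C (e (-t)) := (e (-t)).lipschitz.weaken
        (by exact_mod_cast hC (-t) ⟨by linarith [ht.2], by linarith [ht.1, T.2]⟩)
      exact h2.comp (hb.comp h1)
    · exact (hec.comp continuous_neg).clm_apply
        (hb.continuous.comp (hec.clm_apply continuous_const))
    · have h2 := hC (-t) ⟨by linarith [ht.2], by linarith [ht.1, T.2]⟩
      exact ((e (-t)).le_opNorm _).trans (mul_le_mul h2 (hM _) (norm_nonneg _) C.2)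
    · simp
  obtain ⟨y, hy0, hy⟩ := hPL.exists_eq_forall_mem_Icc_hasDerivWithinAt₀
  refine ⟨fun t => e t (y t), ?_, fun t ht => ?_⟩
  · simp only at hy0
    simp [e, hy0, NormedSpace.exp_zero]
  · have h := (he t).hasDerivWithinAt.clm_apply (hy t ht)
    simp only [f, hinv] at h
    exact h

lemma hasDerivWithinAt_Ici_of_Icc {E : Type*} [NormedAddCommGroup E] [NormedSpace ℝ E]
    {z : ℝ → E} {z' : E} {a b t : ℝ} (h : HasDerivWithinAt z z' (Icc a b) t) (ht : t ∈ Ico a b) :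
    HasDerivWithinAt z z' (Ici t) t :=
  h.mono_of_mem_nhdsWithin
    (mem_of_superset (Icc_mem_nhdsGE ht.2) (Icc_subset_Icc_left ht.1))

end LinearPlusBounded

/-! ### The ODE for the seeds -/

section SeedFlow

variable {N : ℕ} {Ω : Set E3} {R : ℝ} {m : Fin N → ℝ}

@[simp] lemma J_apply_zero (x : E3) : J x 0 = -x 1 := by
  simp [J, matJ, Matrix.ofLp_toEuclideanCLM, Matrix.mulVec, dotProduct, Fin.sum_univ_three]

@[simp] lemma J_apply_one (x : E3) : J x 1 = x 0 := by
  simp [J, matJ, Matrix.ofLp_toEuclideanCLM, Matrix.mulVec, dotProduct, Fin.sum_univ_three]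

@[simp] lemma J_apply_two (x : E3) : J x 2 = 0 := by
  simp [J, matJ, Matrix.ofLp_toEuclideanCLM, Matrix.mulVec, dotProduct, Fin.sum_univ_three]

lemma inner_eq_sum (x y : E3) : inner ℝ x y = x 0 * y 0 + x 1 * y 1 + x 2 * y 2 := by
  simp [PiLp.inner_apply, Fin.sum_univ_three]
  ring

lemma abs_apply_le_norm (x : E3) (k : Fin 3) : |x k| ≤ ‖x‖ := by
  simpa using PiLp.norm_apply_le x k

/-- The velocity of the seeds. -/
noncomputable def velocity (Ω : Set E3) (m : Fin N → ℝ) (z : Fin N → E3) : Fin N → E3 :=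
  fun i => J (z i - centroid Ω m z i)

/-- Integral curves on `[0, T]` of the seed velocity within the set of seed vectors. -/
def IsSeedFlow (Ω : Set E3) (m : Fin N → ℝ) (T : ℝ) (z : ℝ → Fin N → E3) : Prop :=
  ∀ t ∈ Icc 0 T, z t ∈ seedVectors N ∧
    HasDerivWithinAt z (velocity Ω m (z t)) (Icc 0 T) t

/-- Replace the third coordinates of the points `z i` by those of `z₀ i`. -/
noncomputable def setHeights (z₀ z : Fin N → E3) : Fin N → E3 :=
  fun i => z i + (z₀ i 2 - z i 2) • EuclideanSpace.single 2 1

lemma setHeights_apply_two (z₀ z : Fin N → E3) (i : Fin N) : setHeights z₀ z i 2 = z₀ i 2 := by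
  simp [setHeights]

lemma setHeights_eq_self {z₀ z : Fin N → E3} (h : ∀ i, z i 2 = z₀ i 2) : setHeights z₀ z = z := by
  funext i
  simp [setHeights, h i]

lemma norm_setHeights_sub_le (z₀ z z' : Fin N → E3) :
    ‖setHeights z₀ z - setHeights z₀ z'‖ ≤ 2 * ‖z - z'‖ := by
  refine (pi_norm_le_iff_of_nonneg (by positivity)).2 fun i => ?_
  have h : (setHeights z₀ z - setHeights z₀ z') i =
      (z - z') i - ((z - z') i 2) • EuclideanSpace.single 2 1 := by
    simp only [setHeights, Pi.sub_apply, PiLp.sub_apply]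
    module
  rw [h]
  refine (norm_sub_le _ _).trans ?_
  rw [norm_smul, PiLp.norm_single, norm_one, mul_one, Real.norm_eq_abs, two_mul]
  have h1 := norm_le_pi_norm (z - z') i
  exact add_le_add h1 ((abs_apply_le_norm _ 2).trans h1)

/-- The separation holds for every `z`, even with coinciding entries. This is what makes the
nonlinear term Lipschitz on the whole space. -/
lemma le_norm_setHeights_sub {z₀ : Fin N → E3} {r : ℝ}
    (hr : ∀ i j, i ≠ j → r ≤ |(z₀ i - z₀ j) 2|) (z : Fin N → E3) (i j : Fin N) (hij : i ≠ j) :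
    r ≤ ‖setHeights z₀ z i - setHeights z₀ z j‖ := by
  refine le_trans ?_ (abs_apply_le_norm _ 2)
  rw [PiLp.sub_apply, setHeights_apply_two, setHeights_apply_two]
  exact hr i j hij

lemma setHeights_mem_seedVectors {z₀ : Fin N → E3} (hz₀ : IsWellPrepared z₀) (z : Fin N → E3) :
    setHeights z₀ z ∈ seedVectors N := by
  obtain ⟨r, hr, hsep⟩ := hz₀
  intro i j hij h
  have := le_norm_setHeights_sub hsep z i j hij
  rw [h, sub_self, norm_zero] at this
  linarith

/-- The componentwise action of `J`. -/
noncomputable def seedJ (N : ℕ) : (Fin N → E3) →L[ℝ] (Fin N → E3) :=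
  ContinuousLinearMap.pi fun i => J.comp (ContinuousLinearMap.proj i)

@[simp] lemma seedJ_apply (z : Fin N → E3) (i : Fin N) : seedJ N z i = J (z i) := rfl

/-- The nonlinear part of the velocity, for seeds with prescribed heights. -/
noncomputable def forcing (Ω : Set E3) (m : Fin N → ℝ) (z₀ z : Fin N → E3) : Fin N → E3 :=
  fun i => -J (centroid Ω m (setHeights z₀ z) i)

/-- At the prescribed heights the modification is inactive, so the global vector field agrees with
the true velocity. -/
lemma velocity_eq {z₀ z : Fin N → E3} (h : ∀ i, z i 2 = z₀ i 2) :
    velocity Ω m z = seedJ N z + forcing Ω m z₀ z := by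
  funext i
  simp [velocity, forcing, setHeights_eq_self h, sub_eq_add_neg]

lemma IsUnitDomain.exists_forall_norm_forcing_le (hΩ : IsUnitDomain Ω R) (hm : IsMassVector m)
    (z₀ : Fin N → E3) : ∃ M : NNReal, ∀ z, ‖forcing Ω m z₀ z‖ ≤ M := by
  have hR := hΩ.radius_pos.le
  have hmn : ∀ i, 0 ≤ (m i)⁻¹ := fun i => inv_nonneg.2 (hm.1 i).le
  have hnn : ∀ i ∈ Finset.univ, 0 ≤ ‖J‖ * ((m i)⁻¹ * R) := fun i _ =>
    mul_nonneg (norm_nonneg _) (mul_nonneg (hmn i) hR)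
  refine ⟨⟨∑ i, ‖J‖ * ((m i)⁻¹ * R), Finset.sum_nonneg hnn⟩, fun z => ?_⟩
  refine (pi_norm_le_iff_of_nonneg (Finset.sum_nonneg hnn)).2 fun i => ?_
  rw [forcing, norm_neg]
  refine ((J.le_opNorm _).trans (mul_le_mul_of_nonneg_left (hΩ.norm_centroid_le hm _ i)
    (norm_nonneg _))).trans ?_
  exact Finset.single_le_sum hnn (Finset.mem_univ i)

lemma IsUnitDomain.exists_lipschitzWith_forcing (hΩ : IsUnitDomain Ω R) (hm : IsMassVector m)
    {z₀ : Fin N → E3} (hz₀ : IsWellPrepared z₀) :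
    ∃ K : NNReal, LipschitzWith K (forcing Ω m z₀) := by
  obtain ⟨r, hr, hsep⟩ := id hz₀
  have hM := momentConst_nonneg N hΩ.radius_pos hr
  have hmn : ∀ i, 0 ≤ (m i)⁻¹ := fun i => inv_nonneg.2 (hm.1 i).le
  set L : Fin N → ℝ := fun i => ‖J‖ * ((m i)⁻¹ * momentConst N R r * 2) with hL
  have hnn : ∀ i ∈ Finset.univ, 0 ≤ L i := fun i _ =>
    mul_nonneg (norm_nonneg _) (mul_nonneg (mul_nonneg (hmn i) hM) two_pos.le)
  have hnn' := Finset.sum_nonneg hnn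
  refine ⟨⟨∑ i, L i, hnn'⟩, LipschitzWith.of_dist_le_mul fun z z' => ?_⟩
  rw [dist_eq_norm, dist_eq_norm]
  refine (pi_norm_le_iff_of_nonneg (mul_nonneg hnn' (norm_nonneg _))).2 fun i => ?_
  rw [Pi.sub_apply, forcing, forcing, neg_sub_neg, ← map_sub]
  refine (J.le_opNorm _).trans ?_
  have h1 := hΩ.norm_centroid_sub_le hm (setHeights_mem_seedVectors hz₀ z) hr
    (le_norm_setHeights_sub hsep z') i
  have h2 := norm_setHeights_sub_le z₀ z' z
  have h3 : ‖centroid Ω m (setHeights z₀ z') i - centroid Ω m (setHeights z₀ z) i‖ ≤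
      (m i)⁻¹ * momentConst N R r * (2 * ‖z' - z‖) :=
    h1.trans (mul_le_mul_of_nonneg_left h2 (mul_nonneg (hmn i) hM))
  rw [norm_sub_rev z z']
  calc _ ≤ ‖J‖ * ((m i)⁻¹ * momentConst N R r * (2 * ‖z' - z‖)) := by gcongr
    _ = L i * ‖z' - z‖ := by rw [hL]; ring
    _ ≤ _ := by
      refine mul_le_mul_of_nonneg_right ?_ (norm_nonneg _)
      exact Finset.single_le_sum hnn (Finset.mem_univ i)

lemma hasDerivWithinAt_apply {s : Set ℝ} {z : ℝ → E3} {v : E3} {t : ℝ}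
    (hz : HasDerivWithinAt z v s t) (k : Fin 3) : HasDerivWithinAt (fun t => z t k) (v k) s t :=
  (EuclideanSpace.proj (𝕜 := ℝ) k : E3 →L[ℝ] ℝ).hasFDerivAt.comp_hasDerivWithinAt t hz

lemma apply_two_eq_of_hasDerivWithinAt {T : ℝ} {z v : ℝ → Fin N → E3}
    (hz : ∀ t ∈ Icc 0 T, HasDerivWithinAt z (v t) (Icc 0 T) t)
    (hv : ∀ t ∈ Icc 0 T, ∀ i, v t i 2 = 0) {t : ℝ} (ht : t ∈ Icc 0 T) (i : Fin N) :
    z t i 2 = z 0 i 2 := by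
  have hd : ∀ t ∈ Icc 0 T, HasDerivWithinAt (fun t => z t i 2) 0 (Icc 0 T) t := by
    intro t ht
    have h2 := hasDerivWithinAt_apply (hasDerivWithinAt_pi.1 (hz t ht) i) 2
    rw [hv t ht i] at h2
    exact h2
  exact constant_of_has_deriv_right_zero (fun t ht => (hd t ht).continuousWithinAt)
    (fun t ht => hasDerivWithinAt_Ici_of_Icc (hd t ⟨ht.1, ht.2.le⟩) ht) t ht

/-- Solve the modified equation on `[0, T]`; its velocity is horizontal, so the heights stay those
of `z₀` and the modification turns out to be void along the solution. -/
lemma IsUnitDomain.exists_isSeedFlow (hΩ : IsUnitDomain Ω R) (hm : IsMassVector m)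
    {z₀ : Fin N → E3} (hz₀ : IsWellPrepared z₀) {T : ℝ} (hT : 0 ≤ T) :
    ∃ z, IsSeedFlow Ω m T z ∧ z 0 = z₀ := by
  obtain ⟨M, hM⟩ := hΩ.exists_forall_norm_forcing_le hm z₀
  obtain ⟨K, hK⟩ := hΩ.exists_lipschitzWith_forcing hm hz₀
  obtain ⟨z, hz0, hz⟩ := exists_hasDerivWithinAt_linear_add (seedJ N) hK hM hT z₀
  have hheight : ∀ t ∈ Icc 0 T, ∀ i, z t i 2 = z₀ i 2 := fun t ht i => by
    rw [← hz0]
    exact apply_two_eq_of_hasDerivWithinAt hz (fun t _ i => by simp [forcing]) ht i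
  refine ⟨z, fun t ht => ⟨?_, ?_⟩, hz0⟩
  · rw [← setHeights_eq_self (hheight t ht)]
    exact setHeights_mem_seedVectors hz₀ _
  · rw [velocity_eq (hheight t ht)]
    exact hz t ht

lemma IsSeedFlow.apply_two_eq {T : ℝ} {z : ℝ → Fin N → E3} (hz : IsSeedFlow Ω m T z) {t : ℝ}
    (ht : t ∈ Icc 0 T) (i : Fin N) : z t i 2 = z 0 i 2 :=
  apply_two_eq_of_hasDerivWithinAt (fun t ht => (hz t ht).2) (fun t _ i => by simp [velocity]) ht i

/-- Both flows keep the heights of their common initial seeds, hence both solve the same globally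
Lipschitz modified equation. -/
lemma IsSeedFlow.eqOn (hΩ : IsUnitDomain Ω R) (hm : IsMassVector m) {T : ℝ}
    {z y : ℝ → Fin N → E3} (hz : IsSeedFlow Ω m T z) (hy : IsSeedFlow Ω m T y)
    (h0 : z 0 = y 0) (hz₀ : IsWellPrepared (z 0)) : EqOn z y (Icc 0 T) := by
  obtain ⟨K, hK⟩ := hΩ.exists_lipschitzWith_forcing hm hz₀
  have hlip : LipschitzWith (‖seedJ N‖₊ + K) fun x => seedJ N x + forcing Ω m (z 0) x :=
    (seedJ N).lipschitz.add hK
  refine ODE_solution_unique (v := fun _ x => seedJ N x + forcing Ω m (z 0) x) (fun _ => hlip)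
    (fun t ht => (hz t ht).2.continuousWithinAt) (fun t ht => ?_)
    (fun t ht => (hy t ht).2.continuousWithinAt) (fun t ht => ?_) h0
  · have ht' : t ∈ Icc 0 T := ⟨ht.1, ht.2.le⟩
    rw [← velocity_eq fun i => hz.apply_two_eq ht' i]
    exact hasDerivWithinAt_Ici_of_Icc (hz t ht').2 ht
  · have ht' : t ∈ Icc 0 T := ⟨ht.1, ht.2.le⟩
    rw [← velocity_eq fun i => by rw [h0]; exact hy.apply_two_eq ht' i]
    exact hasDerivWithinAt_Ici_of_Icc (hy t ht').2 ht

lemma IsSeedFlow.continuousOn {T : ℝ} {z : ℝ → Fin N → E3} (hz : IsSeedFlow Ω m T z) :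
    ContinuousOn z (Icc 0 T) := fun t ht => (hz t ht).2.continuousWithinAt

lemma IsUnitDomain.continuousOn_velocity_comp (hΩ : IsUnitDomain Ω R) (hm : IsMassVector m)
    {s : Set ℝ} {z : ℝ → Fin N → E3} (hz : ContinuousOn z s)
    (hseed : ∀ t ∈ s, z t ∈ seedVectors N) : ContinuousOn (fun t => velocity Ω m (z t)) s := by
  refine continuousOn_pi.2 fun i => J.continuous.comp_continuousOn (ContinuousOn.sub ?_ ?_)
  · exact continuousOn_pi.1 hz i
  · exact (hΩ.continuousOn_centroid hm i).comp hz hseed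

lemma IsSeedFlow.contDiffOn (hΩ : IsUnitDomain Ω R) (hm : IsMassVector m) {T : ℝ} (hT : 0 < T)
    {z : ℝ → Fin N → E3} (hz : IsSeedFlow Ω m T z) : ContDiffOn ℝ 1 z (Icc 0 T) := by
  rw [contDiffOn_one_iff_derivWithin (uniqueDiffOn_Icc hT)]
  refine ⟨fun t ht => (hz t ht).2.differentiableWithinAt, ?_⟩
  refine (hΩ.continuousOn_velocity_comp hm hz.continuousOn fun t ht => (hz t ht).1).congr
    fun t ht => ?_
  exact (hz t ht).2.derivWithin (uniqueDiffOn_Icc hT t ht)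

end SeedFlow

/-! ### The weak formulation along moving seeds -/

section WeakFormulation

variable {N : ℕ} {Ω : Set E3} {R : ℝ} {m : Fin N → ℝ}

lemma dt_eq_fderiv {φ : E3 × ℝ → ℝ} (hφ : Differentiable ℝ φ) (z : E3) (t : ℝ) :
    dt φ z t = fderiv ℝ φ (z, t) (0, 1) := by
  have h : HasDerivAt (fun s : ℝ => (z, s)) ((0 : E3), (1 : ℝ)) t :=
    (hasDerivAt_const t z).prodMk (hasDerivAt_id t)
  exact ((hφ (z, t)).hasFDerivAt.comp_hasDerivAt t h).deriv

lemma inner_gradz_eq_fderiv {φ : E3 × ℝ → ℝ} (hφ : Differentiable ℝ φ) (z v : E3) (t : ℝ) :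
    inner ℝ v (gradz φ z t) = fderiv ℝ φ (z, t) (v, 0) := by
  have h : HasFDerivAt (fun y : E3 => (y, t)) (ContinuousLinearMap.inl ℝ E3 ℝ) z :=
    hasFDerivAt_prodMk_left z t
  rw [gradz, real_inner_comm, inner_gradient_left]
  have := ((hφ (z, t)).hasFDerivAt.comp z h).fderiv
  simp only [Function.comp_def] at this
  rw [this]
  rfl

lemma dt_add_inner_gradz {φ : E3 × ℝ → ℝ} (hφ : Differentiable ℝ φ) (z v : E3) (t : ℝ) :
    dt φ z t + inner ℝ v (gradz φ z t) = fderiv ℝ φ (z, t) (v, 1) := by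
  rw [dt_eq_fderiv hφ, inner_gradz_eq_fderiv hφ, ← map_add]
  simp

/-- The total derivative of `φ` along the seeds moving with velocities `v`. -/
noncomputable def transportDeriv (m : Fin N → ℝ) (φ : E3 × ℝ → ℝ) (t : ℝ) (z v : Fin N → E3)
    (c : ℝ) : ℝ :=
  ∑ i, m i * fderiv ℝ φ (z i, t) (v i, c)

lemma continuousOn_transportDeriv (m : Fin N → ℝ) {φ : E3 × ℝ → ℝ} (hφ : ContDiff ℝ ∞ φ)
    {s : Set ℝ} {z v : ℝ → Fin N → E3} (hz : ContinuousOn z s) (hv : ContinuousOn v s) (c : ℝ) :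
    ContinuousOn (fun t => transportDeriv m φ t (z t) (v t) c) s := by
  refine continuousOn_finsetSum _ fun i _ => continuousOn_const.mul ?_
  refine ContinuousOn.clm_apply ?_ ((continuousOn_pi.1 hv i).prodMk continuousOn_const)
  exact (hφ.continuous_fderiv (by simp)).comp_continuousOn
    ((continuousOn_pi.1 hz i).prodMk continuousOn_id)

lemma integral_transportDeriv (m : Fin N → ℝ) {φ : E3 × ℝ → ℝ} (hφ : ContDiff ℝ ∞ φ)
    {T : ℝ} (hT : 0 ≤ T) {z v : ℝ → Fin N → E3}
    (hz : ∀ t ∈ Icc 0 T, HasDerivWithinAt z (v t) (Icc 0 T) t) (hv : ContinuousOn v (Icc 0 T)) :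
    ∫ t in (0 : ℝ)..T, transportDeriv m φ t (z t) (v t) 1 =
      (∑ i, m i * φ (z T i, T)) - ∑ i, m i * φ (z 0 i, 0) := by
  have hd : ∀ t ∈ Icc 0 T, HasDerivWithinAt (fun t => ∑ i, m i * φ (z t i, t))
      (transportDeriv m φ t (z t) (v t) 1) (Icc 0 T) t := by
    intro t ht
    refine HasDerivWithinAt.fun_sum fun i _ => HasDerivWithinAt.const_mul _ ?_
    have h1 : HasDerivWithinAt (fun t => (z t i, t)) (v t i, (1 : ℝ)) (Icc 0 T) t :=
      (hasDerivWithinAt_pi.1 (hz t ht) i).prodMk (hasDerivWithinAt_id t (Icc 0 T))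
    exact HasFDerivAt.comp_hasDerivWithinAt (f := fun t => (z t i, t)) t
      ((hφ.differentiable (by simp)) (z t i, t)).hasFDerivAt h1
  have hzc : ContinuousOn z (Icc 0 T) := fun t ht => (hz t ht).continuousWithinAt
  refine intervalIntegral.integral_eq_sub_of_hasDerivAt_of_le hT
    (fun t ht => (hd t ht).continuousWithinAt)
    (fun t ht => (hd t ⟨ht.1.le, ht.2.le⟩).hasDerivAt (Icc_mem_nhds ht.1 ht.2)) ?_
  refine ContinuousOn.intervalIntegrable ?_
  rw [uIcc_of_le hT]
  exact continuousOn_transportDeriv m hφ hzc hv 1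

/-- On each cell `g` is evaluated at a single seed, and `J` is linear, so only the first moment of
the cell enters. No regularity of `g` is needed. -/
lemma IsUnitDomain.integral_inner_brenier (hΩ : IsUnitDomain Ω R) (hm : IsMassVector m)
    {z : Fin N → E3} (hz : z ∈ seedVectors N) (g : E3 → E3) :
    ∫ x in Ω, inner ℝ (J x) (g (∇ (brenier Ω (discreteMeasure m z)) x)) =
      ∑ i, m i * inner ℝ (J (centroid Ω m z i)) (g (z i)) := by
  rw [hΩ.integral_brenier hm hz (f := fun x y => inner ℝ (J x) (g y)) fun i => by fun_prop]
  refine Finset.sum_congr rfl fun i _ => ?_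
  have hid : IntegrableOn (fun x : E3 => x) (Ω ∩ cell z (weights Ω m z) i) :=
    (hΩ.integrableOn continuous_id).mono_set inter_subset_left
  have hJ : IntegrableOn (fun x : E3 => J x) (Ω ∩ cell z (weights Ω m z) i) :=
    (hΩ.integrableOn J.continuous).mono_set inter_subset_left
  simp_rw [real_inner_comm (g (z i))]
  rw [integral_inner hJ, ContinuousLinearMap.integral_comp_comm J hid, ← real_inner_smul_right,
    ← map_smul, smul_centroid hm]
  rfl

lemma IsUnitDomain.weak_formulation (hΩ : IsUnitDomain Ω R) (hm : IsMassVector m)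
    {T : ℝ} (hT : 0 ≤ T) {α : ℝ → Measure E3} {z : ℝ → Fin N → E3} (hz : ContinuousOn z (Icc 0 T))
    (hseed : ∀ t ∈ Icc 0 T, z t ∈ seedVectors N)
    (hα : ∀ t ∈ Icc 0 T, α t = discreteMeasure m (z t))
    {φ : E3 × ℝ → ℝ} (hφ : ContDiff ℝ ∞ φ) :
    (∫ t in (0 : ℝ)..T, ∫ y, (dt φ y t + inner ℝ (J y) (gradz φ y t)) ∂(α t))
        - (∫ t in (0 : ℝ)..T, ∫ x in Ω,
            inner ℝ (J x) (gradz φ (∇ (brenier Ω (α t)) x) t)) =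
      ∫ t in (0 : ℝ)..T, transportDeriv m φ t (z t) (velocity Ω m (z t)) 1 := by
  have hd : Differentiable ℝ φ := hφ.differentiable (by simp)
  have hm0 : ∀ i, 0 ≤ m i := fun i => (hm.1 i).le
  have e1 : ∫ t in (0 : ℝ)..T, ∫ y, (dt φ y t + inner ℝ (J y) (gradz φ y t)) ∂(α t) =
      ∫ t in (0 : ℝ)..T, transportDeriv m φ t (z t) (fun i => J (z t i)) 1 := by
    refine intervalIntegral.integral_congr fun t ht => ?_
    rw [uIcc_of_le hT] at ht
    rw [hα t ht, integral_discreteMeasure hm0]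
    simp only [dt_add_inner_gradz hd, smul_eq_mul, transportDeriv]
  -- The last argument of `transportDeriv` is the time component of the direction: `1` in the first
  -- integral, `0` here, so their difference has direction `(velocity, 1)`.
  have e2 : ∫ t in (0 : ℝ)..T, ∫ x in Ω, inner ℝ (J x) (gradz φ (∇ (brenier Ω (α t)) x) t) =
      ∫ t in (0 : ℝ)..T, transportDeriv m φ t (z t) (fun i => J (centroid Ω m (z t) i)) 0 := by
    refine intervalIntegral.integral_congr fun t ht => ?_
    rw [uIcc_of_le hT] at ht
    rw [hα t ht, hΩ.integral_inner_brenier hm (hseed t ht) (fun y => gradz φ y t)]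
    simp only [inner_gradz_eq_fderiv hd, transportDeriv]
  have c1 : ContinuousOn (fun t i => J (z t i)) (Icc 0 T) :=
    continuousOn_pi.2 fun i => J.continuous.comp_continuousOn (continuousOn_pi.1 hz i)
  have c2 : ContinuousOn (fun t i => J (centroid Ω m (z t) i)) (Icc 0 T) :=
    continuousOn_pi.2 fun i => J.continuous.comp_continuousOn
      ((hΩ.continuousOn_centroid hm i).comp hz hseed)
  rw [e1, e2, ← intervalIntegral.integral_sub]
  · refine intervalIntegral.integral_congr fun t _ => ?_
    simp only [transportDeriv]
    rw [← Finset.sum_sub_distrib]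
    refine Finset.sum_congr rfl fun i _ => ?_
    rw [← mul_sub, ← map_sub]
    simp [velocity]
  · refine ContinuousOn.intervalIntegrable ?_
    rw [uIcc_of_le hT]
    exact continuousOn_transportDeriv m hφ hz c1 1
  · refine ContinuousOn.intervalIntegrable ?_
    rw [uIcc_of_le hT]
    exact continuousOn_transportDeriv m hφ hz c2 0

end WeakFormulation

/-! ### Wasserstein continuity -/

section Curve

variable {N : ℕ} {m : Fin N → ℝ}

lemma sum_ofReal_mass (hm : IsMassVector m) : ∑ i, ENNReal.ofReal (m i) = 1 := by
  rw [← ENNReal.ofReal_sum_of_nonneg fun i _ => (hm.1 i).le, hm.2, ENNReal.ofReal_one]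

lemma discreteMeasure_mem_probCompact (hm : IsMassVector m) (z : Fin N → E3) :
    discreteMeasure m z ∈ ProbCompact := by
  refine ⟨⟨?_⟩, ?_⟩
  · simp [discreteMeasure, sum_ofReal_mass hm]
  · refine (finite_range z).isCompact.of_isClosed_subset Measure.isClosed_support
      (Measure.support_subset_of_isClosed (finite_range z).isClosed ?_)
    filter_upwards [ae_discreteMeasure m z] with y ⟨i, hi⟩
    exact ⟨i, hi.symm⟩

/-- The coupling that carries the `i`-th atom to the `i`-th atom is a competitor, and each atom
moves by at most the sup distance. -/
lemma W2_discreteMeasure_le (hm : IsMassVector m) (z z' : Fin N → E3) :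
    W2 (discreteMeasure m z) (discreteMeasure m z') ≤ edist z z' := by
  set γ : Measure (E3 × E3) := ∑ i, ENNReal.ofReal (m i) • Measure.dirac (z i, z' i) with hγ
  have hmem : γ ∈ couplings (discreteMeasure m z) (discreteMeasure m z') := by
    refine ⟨⟨by simp [hγ, sum_ofReal_mass hm]⟩, ?_, ?_⟩
    · rw [hγ, Measure.map_finset_sum measurable_fst.aemeasurable, discreteMeasure]
      refine Finset.sum_congr rfl fun i _ => ?_
      rw [Measure.map_smul, Measure.map_dirac' measurable_fst]
    · rw [hγ, Measure.map_finset_sum measurable_snd.aemeasurable, discreteMeasure]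
      refine Finset.sum_congr rfl fun i _ => ?_
      rw [Measure.map_smul, Measure.map_dirac' measurable_snd]
  have hcost : ∫⁻ p, edist p.1 p.2 ^ 2 ∂γ ≤ edist z z' ^ 2 := by
    rw [hγ, lintegral_finsetSum_measure]
    calc ∑ i, ∫⁻ p, edist p.1 p.2 ^ 2 ∂(ENNReal.ofReal (m i) • Measure.dirac (z i, z' i))
        ≤ ∑ i, ENNReal.ofReal (m i) * edist z z' ^ 2 := by
          refine Finset.sum_le_sum fun i _ => ?_
          rw [lintegral_smul_measure, lintegral_dirac, smul_eq_mul]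
          gcongr
          exact edist_le_pi_edist z z' i
      _ = edist z z' ^ 2 := by rw [← Finset.sum_mul, sum_ofReal_mass hm, one_mul]
  calc W2 (discreteMeasure m z) (discreteMeasure m z')
      ≤ (edist z z' ^ 2) ^ (1 / 2 : ℝ) :=
        ENNReal.rpow_le_rpow ((iInf₂_le γ hmem).trans hcost) (by norm_num)
    _ = edist z z' := by
        rw [← ENNReal.rpow_natCast, ← ENNReal.rpow_mul]
        norm_num

lemma isContinuousCurve_discreteMeasure (hm : IsMassVector m) {T : ℝ} {z : ℝ → Fin N → E3}
    (hz : ContinuousOn z (Icc 0 T)) : IsContinuousCurve T fun t => discreteMeasure m (z t) := by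
  refine ⟨fun t _ => discreteMeasure_mem_probCompact hm _, fun t ht => ?_⟩
  exact tendsto_of_tendsto_of_tendsto_of_le_of_le tendsto_const_nhds
    (tendsto_iff_edist_tendsto_0.1 (hz t ht)) (fun _ => zero_le)
    fun s => W2_discreteMeasure_le hm (z s) (z t)

end Curve

/-! ### Conservation of energy -/

section Energy

variable {N : ℕ} {Ω : Set E3} {R : ℝ} {m : Fin N → ℝ}

/-- The correlation `∑ i, m i ⟪centroid i, z' i⟫` of the optimal cells of `z` with seeds `z'`. -/
noncomputable def correlation (Ω : Set E3) (m : Fin N → ℝ) (z z' : Fin N → E3) : ℝ :=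
  ∑ i, m i * inner ℝ (centroid Ω m z i) (z' i)

lemma IsUnitDomain.correlation_eq_sum (hΩ : IsUnitDomain Ω R) (hm : IsMassVector m)
    (z z' : Fin N → E3) :
    correlation Ω m z z' = ∑ i, ∫ x in Ω ∩ cell z (weights Ω m z) i, inner ℝ x (z' i) := by
  refine Finset.sum_congr rfl fun i _ => ?_
  have hid : IntegrableOn (fun x : E3 => x) (Ω ∩ cell z (weights Ω m z) i) :=
    (hΩ.integrableOn continuous_id).mono_set inter_subset_left
  simp_rw [real_inner_comm (z' i)]
  rw [integral_inner hid, ← smul_eq_mul, ← inner_smul_right_eq_smul, smul_centroid hm]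
  rfl

lemma IsUnitDomain.sum_integral_cell (hΩ : IsUnitDomain Ω R) [NeZero N] {z : Fin N → E3}
    (hz : z ∈ seedVectors N) (w : Fin N → ℝ) {f : E3 → ℝ} (hf : Continuous f) :
    ∑ i, ∫ x in Ω ∩ cell z w i, f x = ∫ x in Ω, f x := by
  conv_rhs => rw [hΩ.restrict_eq_sum hz w]
  rw [integral_finsetSum_measure fun i _ => (hΩ.integrableOn hf).mono_set inter_subset_left]

/-- Among partitions into cells of volumes `m`, the Laguerre cells of `z'` correlate best with `z'`.
Adding `∑ i, m i * w' i` to both sides bounds the left one by the integral of the envelope and turns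
the right one into that integral. -/
lemma IsUnitDomain.correlation_le (hΩ : IsUnitDomain Ω R) (hm : IsMassVector m)
    {z z' : Fin N → E3} (hz : z ∈ seedVectors N) (hz' : z' ∈ seedVectors N) :
    correlation Ω m z z' ≤ correlation Ω m z' z' := by
  have := hm.neZero
  set w' := weights Ω m z' with hw'
  have hshift : ∀ y ∈ seedVectors N, correlation Ω m y z' + ∑ i, m i * w' i =
      ∑ i, ∫ x in Ω ∩ cell y (weights Ω m y) i, (inner ℝ x (z' i) + w' i) := by
    intro y hy
    rw [hΩ.correlation_eq_sum hm, ← Finset.sum_add_distrib]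
    refine Finset.sum_congr rfl fun i _ => ?_
    have h1 : Continuous fun x : E3 => inner ℝ x (z' i) := by fun_prop
    rw [integral_add ((hΩ.integrableOn h1).mono_set inter_subset_left)
      ((hΩ.integrableOn continuous_const).mono_set inter_subset_left), setIntegral_const,
      smul_eq_mul, Measure.real, hΩ.isAdapted_weights hm hy i, ENNReal.toReal_ofReal (hm.1 i).le]
  have henv := (lipschitzWith_envelope z' w').continuous
  have hlin : ∀ i, Continuous fun x : E3 => inner ℝ x (z' i) + w' i := fun i => by fun_prop
  have h1 := hshift z hz
  have h2 := hshift z' hz'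
  have h3 : ∑ i, ∫ x in Ω ∩ cell z (weights Ω m z) i, (inner ℝ x (z' i) + w' i) ≤
      ∫ x in Ω, envelope z' w' x := by
    rw [← hΩ.sum_integral_cell hz (weights Ω m z) henv]
    refine Finset.sum_le_sum fun i _ => ?_
    exact integral_mono ((hΩ.integrableOn (hlin i)).mono_set inter_subset_left)
      ((hΩ.integrableOn henv).mono_set inter_subset_left) fun x => le_envelope z' w' x i
  have h4 : ∑ i, ∫ x in Ω ∩ cell z' (weights Ω m z') i, (inner ℝ x (z' i) + w' i) =
      ∫ x in Ω, envelope z' w' x := by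
    rw [← hΩ.sum_integral_cell hz' (weights Ω m z') henv]
    refine Finset.sum_congr rfl fun i _ => ?_
    exact setIntegral_congr_fun (hΩ.measurableSet_cell _ _ _) fun x hx =>
      (envelope_eq_of_mem_cell hx.2).symm
  linarith

lemma correlation_sub_right (Ω : Set E3) (m : Fin N → ℝ) (z y y' : Fin N → E3) :
    correlation Ω m z (y - y') = correlation Ω m z y - correlation Ω m z y' := by
  simp only [correlation, ← Finset.sum_sub_distrib, Pi.sub_apply, inner_sub_right, mul_sub]

/-- By maximality used in both directions, the remainder lies between `0` and `correlation Ω m z'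
(z' - z) - correlation Ω m z (z' - z)`, which is quadratic since centroids are Lipschitz. So the
centroids may be held fixed when differentiating, although they are only Lipschitz. -/
lemma IsUnitDomain.abs_correlation_sub_le (hΩ : IsUnitDomain Ω R) (hm : IsMassVector m)
    {z z' : Fin N → E3} (hz : z ∈ seedVectors N) (hz' : z' ∈ seedVectors N) {ρ : ℝ} (hρ : 0 < ρ)
    (hsep : ∀ i j, i ≠ j → ρ ≤ ‖z i - z j‖) :
    |correlation Ω m z' z' - correlation Ω m z z - correlation Ω m z (z' - z)| ≤
      N * momentConst N R ρ * ‖z' - z‖ ^ 2 := by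
  have h1 := hΩ.correlation_le hm hz hz'
  have h2 := hΩ.correlation_le hm hz' hz
  have h3 := correlation_sub_right Ω m z z' z
  have h4 := correlation_sub_right Ω m z' z' z
  have h5 : |correlation Ω m z' (z' - z) - correlation Ω m z (z' - z)| ≤
      N * momentConst N R ρ * ‖z' - z‖ ^ 2 := by
    rw [correlation, correlation, ← Finset.sum_sub_distrib]
    refine (Finset.abs_sum_le_sum_abs _ _).trans ?_
    refine (Finset.sum_le_card_nsmul _ _ (momentConst N R ρ * ‖z' - z‖ ^ 2) fun i _ => ?_).trans
      (le_of_eq ?_)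
    · rw [← mul_sub, ← inner_sub_left, abs_mul, abs_of_pos (hm.1 i)]
      have hc := hΩ.norm_centroid_sub_le hm hz' hρ hsep i
      rw [norm_sub_rev, norm_sub_rev z z'] at hc
      have hmi := hm.1 i
      calc m i * |inner ℝ (centroid Ω m z' i - centroid Ω m z i) ((z' - z) i)|
          ≤ m i * (((m i)⁻¹ * momentConst N R ρ * ‖z' - z‖) * ‖z' - z‖) := by
            refine mul_le_mul_of_nonneg_left ((abs_real_inner_le_norm _ _).trans ?_) hmi.le
            exact mul_le_mul hc (norm_le_pi_norm (z' - z) i) (norm_nonneg _)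
              ((norm_nonneg _).trans hc)
        _ = momentConst N R ρ * ‖z' - z‖ ^ 2 := by field_simp
    · rw [Finset.card_univ, Fintype.card_fin, nsmul_eq_mul, mul_assoc]
  have h6 : 0 ≤ N * momentConst N R ρ * ‖z' - z‖ ^ 2 := (abs_nonneg _).trans h5
  rw [abs_le] at h5 ⊢
  constructor <;> linarith

lemma IsUnitDomain.hasDerivWithinAt_correlation (hΩ : IsUnitDomain Ω R) (hm : IsMassVector m)
    {s : Set ℝ} {z : ℝ → Fin N → E3} {v : Fin N → E3} {t : ℝ} (ht : t ∈ s)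
    (hseed : ∀ t ∈ s, z t ∈ seedVectors N) (hz : HasDerivWithinAt z v s t) :
    HasDerivWithinAt (fun t => correlation Ω m (z t) (z t)) (correlation Ω m (z t) v) s t := by
  obtain ⟨ρ, hρ, hsep⟩ := exists_separation (hseed t ht)
  have hlin : HasDerivWithinAt (fun s' => correlation Ω m (z t) (z s'))
      (correlation Ω m (z t) v) s t := by
    refine HasDerivWithinAt.fun_sum fun i _ => HasDerivWithinAt.const_mul _ ?_
    have h := (hasDerivWithinAt_const t s (centroid Ω m (z t) i)).inner ℝ
      (hasDerivWithinAt_pi.1 hz i)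
    simpa using h
  have hrem : HasDerivWithinAt (fun s' => correlation Ω m (z s') (z s') -
      correlation Ω m (z t) (z s')) 0 s t := by
    rw [hasDerivWithinAt_iff_isLittleO]
    have hO : (fun s' => z s' - z t) =O[𝓝[s] t] fun s' => s' - t := hz.hasFDerivWithinAt.isBigO_sub
    have h1 : (fun s' => ‖z s' - z t‖ ^ 2) =o[𝓝[s] t] fun s' => s' - t := by
      have hlim : Tendsto (fun s' => ‖z s' - z t‖) (𝓝[s] t) (𝓝 0) :=
        tendsto_iff_norm_sub_tendsto_zero.1 hz.continuousWithinAt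
      have ho : (fun s' => ‖z s' - z t‖) =o[𝓝[s] t] fun _ => (1 : ℝ) :=
        (Asymptotics.isLittleO_one_iff ℝ).2 hlim
      have := ho.mul_isBigO hO.norm_left
      simpa [pow_two] using this
    refine Asymptotics.IsBigO.trans_isLittleO ?_ h1
    refine Asymptotics.IsBigO.of_bound (N * momentConst N R ρ) ?_
    filter_upwards [self_mem_nhdsWithin] with s' hs'
    have := hΩ.abs_correlation_sub_le hm (hseed t ht) (hseed s' hs') hρ hsep
    rw [correlation_sub_right] at this
    rw [Real.norm_eq_abs, Real.norm_of_nonneg (by positivity)]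
    refine le_trans (le_of_eq ?_) this
    congr 1
    rw [smul_zero]
    ring
  have h := hlin.add hrem
  rw [add_zero] at h
  exact h.congr (fun s' _ => by simp) (by simp)

/-- The cross terms of the horizontal squares and the vertical term combine into the full inner
product `-⟪x, y⟫`. -/
lemma IsUnitDomain.geostrophicEnergy_eq (hΩ : IsUnitDomain Ω R) (hm : IsMassVector m)
    {z : Fin N → E3} (hz : z ∈ seedVectors N) :
    geostrophicEnergy Ω (discreteMeasure m z) =
      (∫ x in Ω, (1 / 2) * (x 0 ^ 2 + x 1 ^ 2)) +
        (∑ i, m i * ((1 / 2) * (z i 0 ^ 2 + z i 1 ^ 2))) - correlation Ω m z z := by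
  have := hm.neZero
  have hq : Continuous fun x : E3 => (1 / 2) * (x 0 ^ 2 + x 1 ^ 2) := by fun_prop
  rw [geostrophicEnergy, hΩ.integral_brenier hm hz (f := fun x y : E3 =>
    (1 / 2) * ((y 0 - x 0) ^ 2 + (y 1 - x 1) ^ 2) - x 2 * y 2) fun i => by fun_prop,
    hΩ.correlation_eq_sum hm, ← hΩ.sum_integral_cell hz (weights Ω m z) hq,
    ← Finset.sum_add_distrib, ← Finset.sum_sub_distrib]
  refine Finset.sum_congr rfl fun i _ => ?_
  have hlin : Continuous fun x : E3 => inner ℝ x (z i) := by fun_prop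
  have i1 : IntegrableOn (fun x : E3 => (1 / 2) * (x 0 ^ 2 + x 1 ^ 2))
    (Ω ∩ cell z (weights Ω m z) i) := (hΩ.integrableOn hq).mono_set inter_subset_left
  have i2 : IntegrableOn (fun _ : E3 => (1 / 2) * (z i 0 ^ 2 + z i 1 ^ 2))
    (Ω ∩ cell z (weights Ω m z) i) :=
    (hΩ.integrableOn continuous_const).mono_set inter_subset_left
  have i3 := (hΩ.integrableOn hlin).mono_set
    (inter_subset_left (s := Ω) (t := cell z (weights Ω m z) i))
  have hc : m i * ((1 / 2) * (z i 0 ^ 2 + z i 1 ^ 2)) =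
      ∫ x in Ω ∩ cell z (weights Ω m z) i, (1 / 2) * (z i 0 ^ 2 + z i 1 ^ 2) := by
    rw [setIntegral_const, smul_eq_mul, Measure.real, hΩ.isAdapted_weights hm hz i,
      ENNReal.toReal_ofReal (hm.1 i).le]
  have i12 : IntegrableOn (fun x : E3 => (1 / 2) * (x 0 ^ 2 + x 1 ^ 2) +
      (1 / 2) * (z i 0 ^ 2 + z i 1 ^ 2)) (Ω ∩ cell z (weights Ω m z) i) := i1.add i2
  rw [hc, ← integral_add i1 i2, ← integral_sub i12 i3]
  refine integral_congr_ae (ae_of_all _ fun x => ?_)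
  simp only [inner_eq_sum]
  ring

/-- As the velocity is horizontal, each seed contributes `m i * ⟪z i - c i, J (z i - c i)⟫` to the
derivative, with `c i` the centroid; this vanishes because `J` is antisymmetric. -/
lemma IsSeedFlow.geostrophicEnergy_eq (hΩ : IsUnitDomain Ω R) (hm : IsMassVector m) {T : ℝ}
    {z : ℝ → Fin N → E3} (hz : IsSeedFlow Ω m T z) {t : ℝ} (ht : t ∈ Icc 0 T) :
    geostrophicEnergy Ω (discreteMeasure m (z t)) =
      geostrophicEnergy Ω (discreteMeasure m (z 0)) := by
  set f : ℝ → ℝ := fun t =>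
    (∑ i, m i * ((1 / 2) * (z t i 0 ^ 2 + z t i 1 ^ 2))) - correlation Ω m (z t) (z t) with hf
  have hd : ∀ t ∈ Icc 0 T, HasDerivWithinAt f 0 (Icc 0 T) t := by
    intro t ht
    have h1 : HasDerivWithinAt (fun t => ∑ i, m i * ((1 / 2) * (z t i 0 ^ 2 + z t i 1 ^ 2)))
        (∑ i, m i * (z t i 0 * velocity Ω m (z t) i 0 + z t i 1 * velocity Ω m (z t) i 1))
        (Icc 0 T) t := by
      refine HasDerivWithinAt.fun_sum fun i _ => HasDerivWithinAt.const_mul _ ?_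
      have hi := hasDerivWithinAt_pi.1 (hz t ht).2 i
      have h := (((hasDerivWithinAt_apply hi 0).fun_pow 2).add
        ((hasDerivWithinAt_apply hi 1).fun_pow 2)).const_mul (1 / 2)
      refine h.congr_deriv ?_
      push_cast
      ring
    have h2 := hΩ.hasDerivWithinAt_correlation hm ht (fun t ht => (hz t ht).1) (hz t ht).2
    refine (h1.sub h2).congr_deriv ?_
    rw [correlation, ← Finset.sum_sub_distrib]
    refine Finset.sum_eq_zero fun i _ => ?_
    rw [inner_eq_sum]
    simp only [velocity, J_apply_zero, J_apply_one, J_apply_two, PiLp.sub_apply]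
    ring
  have hconst := constant_of_has_deriv_right_zero (fun t ht => (hd t ht).continuousWithinAt)
    (fun t ht => hasDerivWithinAt_Ici_of_Icc (hd t ⟨ht.1, ht.2.le⟩) ht) t ht
  have h0 : (0 : ℝ) ∈ Icc 0 T := ⟨le_rfl, ht.1.trans ht.2⟩
  rw [hΩ.geostrophicEnergy_eq hm (hz t ht).1, hΩ.geostrophicEnergy_eq hm (hz 0 h0).1,
    add_sub_assoc, add_sub_assoc]
  exact congrArg _ hconst

end Energy

/-! ### From weak solutions back to the seed ODE -/

section Identification

variable {N N' : ℕ} {Ω : Set E3} {R : ℝ} {m : Fin N → ℝ} {m' : Fin N' → ℝ}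

/-- A product test function `(z, t) ↦ χ t * Ψ z`. -/
def prodTest (χ : ℝ → ℝ) (Ψ : E3 → ℝ) (p : E3 × ℝ) : ℝ := χ p.2 * Ψ p.1

lemma contDiff_prodTest {χ : ℝ → ℝ} {Ψ : E3 → ℝ} (hχ : ContDiff ℝ ∞ χ) (hΨ : ContDiff ℝ ∞ Ψ) :
    ContDiff ℝ ∞ (prodTest χ Ψ) :=
  (hχ.comp contDiff_snd).mul (hΨ.comp contDiff_fst)

lemma hasCompactSupport_prodTest {χ : ℝ → ℝ} {Ψ : E3 → ℝ} (hχ : HasCompactSupport χ)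
    (hΨ : HasCompactSupport Ψ) : HasCompactSupport (prodTest χ Ψ) := by
  refine HasCompactSupport.intro (hΨ.isCompact.prod hχ.isCompact) fun p hp => ?_
  rw [mem_prod, not_and_or] at hp
  rcases hp with h | h
  · rw [prodTest, image_eq_zero_of_notMem_tsupport h, mul_zero]
  · rw [prodTest, image_eq_zero_of_notMem_tsupport h, zero_mul]

lemma fderiv_prodTest {χ : ℝ → ℝ} {Ψ : E3 → ℝ} (hχ : ContDiff ℝ ∞ χ) (hΨ : ContDiff ℝ ∞ Ψ)
    (z u : E3) (t : ℝ) :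
    fderiv ℝ (prodTest χ Ψ) (z, t) (u, 0) = χ t * fderiv ℝ Ψ z u := by
  have hd : Differentiable ℝ (prodTest χ Ψ) := (contDiff_prodTest hχ hΨ).differentiable (by simp)
  rw [← inner_gradz_eq_fderiv hd, gradz, real_inner_comm, inner_gradient_left]
  have h : (fun y => prodTest χ Ψ (y, t)) = fun y => χ t * Ψ y := rfl
  rw [h, fderiv_const_mul (hΨ.differentiable (by simp) z)]
  rfl

/-- Subtracting the fundamental theorem of calculus along the actual paths from the weak equation
removes the time derivative of `φ` and the terms at `T`. What remains tests the velocity defect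
against the mismatch of initial data. -/
lemma IsUnitDomain.integral_transportDeriv_sub (hΩ : IsUnitDomain Ω R) (hm : IsMassVector m)
    {T : ℝ} (hT : 0 ≤ T) {α₀ : Measure E3} {β : ℝ → Measure E3} {z v : ℝ → Fin N → E3}
    (hz : ∀ t ∈ Icc 0 T, HasDerivWithinAt z (v t) (Icc 0 T) t) (hv : ContinuousOn v (Icc 0 T))
    (hseed : ∀ t ∈ Icc 0 T, z t ∈ seedVectors N)
    (hβ : ∀ t ∈ Icc 0 T, β t = discreteMeasure m (z t))
    (hsol : IsGeostrophicSolution Ω T α₀ β) {φ : E3 × ℝ → ℝ} (hφ : ContDiff ℝ ∞ φ)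
    (hφc : HasCompactSupport φ) :
    ∫ t in (0 : ℝ)..T, transportDeriv m φ t (z t) (velocity Ω m (z t) - v t) 0 =
      (∑ i, m i * φ (z 0 i, 0)) - ∫ y, φ (y, 0) ∂α₀ := by
  have hzc : ContinuousOn z (Icc 0 T) := fun t ht => (hz t ht).continuousWithinAt
  have h1 := hsol.2 φ hφ hφc
  rw [hΩ.weak_formulation hm hT hzc hseed hβ hφ, hβ T ⟨hT, le_rfl⟩,
    integral_discreteMeasure fun i => (hm.1 i).le] at h1
  have h2 := integral_transportDeriv m hφ hT hz hv
  have h3 : ∫ t in (0 : ℝ)..T, transportDeriv m φ t (z t) (velocity Ω m (z t) - v t) 0 =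
      (∫ t in (0 : ℝ)..T, transportDeriv m φ t (z t) (velocity Ω m (z t)) 1) -
        ∫ t in (0 : ℝ)..T, transportDeriv m φ t (z t) (v t) 1 := by
    rw [← intervalIntegral.integral_sub]
    · refine intervalIntegral.integral_congr fun t _ => ?_
      simp only [transportDeriv]
      rw [← Finset.sum_sub_distrib]
      refine Finset.sum_congr rfl fun i _ => ?_
      rw [← mul_sub, ← map_sub]
      simp
    · refine ContinuousOn.intervalIntegrable ?_
      rw [uIcc_of_le hT]
      exact continuousOn_transportDeriv m hφ hzc (hΩ.continuousOn_velocity_comp hm hzc hseed) 1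
    · refine ContinuousOn.intervalIntegrable ?_
      rw [uIcc_of_le hT]
      exact continuousOn_transportDeriv m hφ hzc hv 1
  rw [h3, h1, h2]
  simp only [smul_eq_mul]
  ring

/-- If the defect `h` of the `k`-th seed were nonzero at an interior time, a test function
concentrated near that time and seed, with spatial gradient parallel to `h` along the path of that
seed, would make the defect integral positive, whereas it must vanish. -/
lemma eq_velocity_of_isGeostrophicSolution (hΩ : IsUnitDomain Ω R) (hm : IsMassVector m)
    {T : ℝ} (hT : 0 < T) {α₀ : Measure E3} {β : ℝ → Measure E3} {z v : ℝ → Fin N → E3}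
    (hz : ∀ t ∈ Icc 0 T, HasDerivWithinAt z (v t) (Icc 0 T) t) (hv : ContinuousOn v (Icc 0 T))
    (hseed : ∀ t ∈ Icc 0 T, z t ∈ seedVectors N)
    (hβ : ∀ t ∈ Icc 0 T, β t = discreteMeasure m (z t))
    (hsol : IsGeostrophicSolution Ω T α₀ β) :
    ∀ t ∈ Icc 0 T, v t = velocity Ω m (z t) := by
  have hzc : ContinuousOn z (Icc 0 T) := fun t ht => (hz t ht).continuousWithinAt
  have hvel := hΩ.continuousOn_velocity_comp hm hzc hseed
  set u : ℝ → Fin N → E3 := fun t => velocity Ω m (z t) - v t with hu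
  have huc : ContinuousOn u (Icc 0 T) := hvel.sub hv
  -- Continuity of both sides extends the identity from the open interval, where test functions
  -- vanishing at time `0` are available.
  suffices hint : EqOn v (fun t => velocity Ω m (z t)) (Ioo 0 T) from
    hint.of_subset_closure hv hvel Ioo_subset_Icc_self (by rw [closure_Ioo hT.ne])
  intro t₀ ht₀
  have ht₀' : t₀ ∈ Icc 0 T := ⟨ht₀.1.le, ht₀.2.le⟩
  funext k
  by_contra hne
  set h : E3 := u t₀ k with hh
  have hh0 : h ≠ 0 := fun h0 => hne (sub_eq_zero.1 h0).symm
  obtain ⟨ρ, hρ, hsep⟩ := exists_separation (hseed t₀ ht₀')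
  have hnhds : Icc 0 T ∈ 𝓝 t₀ := Icc_mem_nhds ht₀.1 ht₀.2
  have hzt : ∀ i, ContinuousAt (fun t => z t i) t₀ := fun i =>
    (continuousOn_pi.1 hzc i).continuousAt hnhds
  have hut : ContinuousAt (fun t => u t k) t₀ := (continuousOn_pi.1 huc k).continuousAt hnhds
  have hev : ∀ᶠ t in 𝓝 t₀, t ∈ Ioo 0 T ∧ (∀ i, dist (z t i) (z t₀ i) < ρ / 3) ∧
      0 < inner ℝ (u t k) h := by
    refine Eventually.and (Ioo_mem_nhds ht₀.1 ht₀.2) (Eventually.and ?_ ?_)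
    · exact eventually_all.2 fun i => Metric.tendsto_nhds.1 (hzt i) _ (by positivity)
    · refine (hut.inner continuousAt_const).eventually_const_lt ?_
      exact real_inner_self_pos.2 hh0
  obtain ⟨η, hη, hball⟩ := Metric.eventually_nhds_iff.1 hev
  let χ : ContDiffBump t₀ := ⟨η / 2, η, by positivity, by linarith⟩
  -- While `dist t t₀ < η`, every seed stays within `ρ / 3` of its position at `t₀`. Hence the
  -- `k`-th one sees `ψ = 1`, and the others, beyond `2 * ρ / 3`, see `ψ = 0`.
  let ψ : ContDiffBump (z t₀ k) := ⟨ρ / 3, 2 * ρ / 3, by positivity, by linarith⟩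
  let Ψ : E3 → ℝ := fun y => ψ y * inner ℝ y h
  have hΨ : ContDiff ℝ ∞ Ψ := ψ.contDiff.mul (contDiff_id.inner ℝ contDiff_const)
  have hΨc : HasCompactSupport Ψ := ψ.hasCompactSupport.mul_right
  have hχ0 : ∀ t, η ≤ dist t t₀ → χ t = 0 := fun t ht => χ.zero_of_le_dist ht
  have hΨk : ∀ y, dist y (z t₀ k) < ρ / 3 → ∀ a, fderiv ℝ Ψ y a = inner ℝ a h := by
    intro y hy a
    have : Ψ =ᶠ[𝓝 y] fun y => inner ℝ h y := by
      filter_upwards [ψ.eventuallyEq_one_of_mem_ball (Metric.mem_ball.2 hy)] with x hx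
      rw [show Ψ x = ψ x * inner ℝ x h from rfl, hx, Pi.one_apply, one_mul, real_inner_comm]
    rw [this.fderiv_eq, real_inner_comm]
    exact congrArg (fun L : E3 →L[ℝ] ℝ => L a) (InnerProductSpace.toDual ℝ E3 h).fderiv
  have hΨj : ∀ y, 2 * ρ / 3 < dist y (z t₀ k) → ∀ a, fderiv ℝ Ψ y a = 0 := by
    intro y hy a
    have : Ψ =ᶠ[𝓝 y] fun _ => 0 := by
      have hc : Continuous fun y => dist y (z t₀ k) := by fun_prop
      filter_upwards [(hc.tendsto y).eventually_const_lt hy] with x hx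
      rw [show Ψ x = ψ x * inner ℝ x h from rfl, ψ.zero_of_le_dist hx.le, zero_mul]
    rw [this.fderiv_eq]
    simp
  have hval : ∀ t, transportDeriv m (prodTest χ Ψ) t (z t) (u t) 0 =
      if dist t t₀ < η then m k * (χ t * inner ℝ (u t k) h) else 0 := by
    intro t
    simp only [transportDeriv, fderiv_prodTest χ.contDiff hΨ]
    split_ifs with ht
    · obtain ⟨-, hd, -⟩ := hball ht
      rw [Finset.sum_eq_single k]
      · rw [hΨk _ (hd k)]
      · intro j _ hj
        rw [hΨj, mul_zero, mul_zero]
        have h1 := hsep j k hj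
        rw [← dist_eq_norm] at h1
        have h2 := dist_triangle (z t₀ j) (z t j) (z t₀ k)
        have h3 := hd j
        rw [dist_comm] at h3
        linarith
      · simp
    · refine Finset.sum_eq_zero fun j _ => ?_
      rw [hχ0 t (not_lt.1 ht)]
      ring
  have hkey := hΩ.integral_transportDeriv_sub hm hT.le hz hv hseed hβ hsol
    (contDiff_prodTest χ.contDiff hΨ) (hasCompactSupport_prodTest χ.hasCompactSupport hΨc)
  have h00 : ∀ y, prodTest χ Ψ (y, 0) = 0 := fun y => by
    have : η ≤ dist 0 t₀ := by
      by_contra! hlt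
      exact lt_irrefl _ (hball hlt).1.1
    simp only [prodTest, hχ0 0 this, zero_mul]
  simp only [h00, mul_zero, Finset.sum_const_zero, integral_zero, sub_zero] at hkey
  have hpos : 0 < ∫ t in (0 : ℝ)..T, transportDeriv m (prodTest χ Ψ) t (z t) (u t) 0 := by
    refine intervalIntegral.integral_pos hT
      (continuousOn_transportDeriv m (contDiff_prodTest χ.contDiff hΨ) hzc huc 0)
      (fun t _ => ?_) ⟨t₀, ht₀', ?_⟩
    · rw [hval]
      split_ifs with ht
      · exact mul_nonneg (hm.1 k).le (mul_nonneg χ.nonneg (hball ht).2.2.le)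
      · exact le_rfl
    · have ht : dist t₀ t₀ < η := by rwa [dist_self]
      rw [hval, if_pos ht, χ.one_of_mem_closedBall (Metric.mem_closedBall_self χ.rIn_pos.le), one_mul]
      exact mul_pos (hm.1 k) (hball ht).2.2
  exact hpos.ne' hkey

/-- The test functions separate a point from finitely many others. -/
lemma exists_test_eq_one (p : E3) (F : Finset E3) :
    ∃ Ψ : E3 → ℝ, ContDiff ℝ ∞ Ψ ∧ HasCompactSupport Ψ ∧ Ψ p = 1 ∧ ∀ q ∈ F, q ≠ p → Ψ q = 0 := by
  have hcl : IsClosed ((F.erase p : Finset E3) : Set E3) := (F.erase p).finite_toSet.isClosed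
  have hp : p ∉ ((F.erase p : Finset E3) : Set E3) := by simp
  obtain ⟨ε, hε, hball⟩ := Metric.isOpen_iff.1 hcl.isOpen_compl p hp
  let ψ : ContDiffBump p := ⟨ε / 2, ε, by positivity, by linarith⟩
  refine ⟨ψ, ψ.contDiff, ψ.hasCompactSupport,
    ψ.one_of_mem_closedBall (Metric.mem_closedBall_self ψ.rIn_pos.le), fun q hq hqp => ?_⟩
  refine ψ.zero_of_le_dist (le_of_not_gt fun hlt => ?_)
  exact hball (Metric.mem_ball.2 hlt) (by simp [hq, hqp])

/-- A test function equal to `1` at `z i` and `0` at all other points of both families isolates the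
mass at `z i`; its positivity forces a matching atom. -/
lemma exists_eq_of_forall_test_eq (hm : IsMassVector m) {z : Fin N → E3}
    {z' : Fin N' → E3} (hz : z ∈ seedVectors N) (hz' : z' ∈ seedVectors N')
    (h : ∀ Ψ : E3 → ℝ, ContDiff ℝ ∞ Ψ → HasCompactSupport Ψ →
      ∑ i, m i * Ψ (z i) = ∑ j, m' j * Ψ (z' j)) (i : Fin N) :
    ∃ j, z' j = z i ∧ m' j = m i := by
  classical
  obtain ⟨Ψ, hΨ, hΨc, h1, h0⟩ := exists_test_eq_one (z i)
    (Finset.univ.image z ∪ Finset.univ.image z')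
  have hs := h Ψ hΨ hΨc
  rw [Finset.sum_eq_single i (fun l _ hl => by
    rw [h0 (z l) (by simp) (hz l i hl), mul_zero]) (by simp), h1, mul_one] at hs
  by_cases hex : ∃ j, z' j = z i
  · obtain ⟨j, hj⟩ := hex
    refine ⟨j, hj, ?_⟩
    rw [Finset.sum_eq_single j (fun l _ hl => by
      rw [h0 (z' l) (by simp) (hj ▸ hz' l j hl), mul_zero]) (by simp), hj, h1, mul_one] at hs
    exact hs.symm
  · push Not at hex
    rw [Finset.sum_eq_zero fun l _ => by rw [h0 (z' l) (by simp) (hex l), mul_zero]] at hs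
    exact absurd hs (hm.1 i).ne'

lemma injective_of_mem_seedVectors {z : Fin N → E3} (hz : z ∈ seedVectors N) :
    Function.Injective z := fun i j h => by_contra fun hij => hz i j hij h

lemma exists_equiv_of_forall_test_eq (hm : IsMassVector m) (hm' : IsMassVector m')
    {z : Fin N → E3} {z' : Fin N' → E3} (hz : z ∈ seedVectors N) (hz' : z' ∈ seedVectors N')
    (h : ∀ Ψ : E3 → ℝ, ContDiff ℝ ∞ Ψ → HasCompactSupport Ψ →
      ∑ i, m i * Ψ (z i) = ∑ j, m' j * Ψ (z' j)) :
    ∃ σ : Fin N ≃ Fin N', ∀ i, z' (σ i) = z i ∧ m' (σ i) = m i := by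
  choose f hf using exists_eq_of_forall_test_eq hm hz hz' h
  choose g hg using exists_eq_of_forall_test_eq hm' hz' hz fun Ψ h1 h2 => (h Ψ h1 h2).symm
  refine ⟨⟨f, g, fun i => ?_, fun j => ?_⟩, hf⟩
  · exact injective_of_mem_seedVectors hz ((hg (f i)).1.trans (hf i).1)
  · exact injective_of_mem_seedVectors hz' ((hf (g j)).1.trans (hg j).1)

/-- The hypothesis provides distinct atoms for some representation, not for `z` itself. These `N`
charged points must all occur among the `N` entries of `z`, so by counting `z` is injective. -/
lemma mem_seedVectors_of_mem_discreteMeasures {z : Fin N → E3}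
    (h : discreteMeasure m z ∈ discreteMeasures N) : z ∈ seedVectors N := by
  obtain ⟨m', z', hm', hz', heq⟩ := h
  have hex : ∀ i, ∃ j, z j = z' i := by
    intro i
    by_contra! hne
    have h1 : discreteMeasure m z {z' i} = 0 := by
      refine measure_mono_null ?_ (ae_iff.1 (ae_discreteMeasure m z))
      rintro y rfl ⟨j, hj⟩
      exact hne j hj.symm
    rw [heq, discreteMeasure, Measure.finsetSum_apply, Finset.sum_eq_zero_iff] at h1
    have h2 := h1 i (Finset.mem_univ i)
    simp at h2
    linarith [hm'.1 i]
  choose g hg using hex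
  have hginj : Function.Injective g := fun i j hij =>
    injective_of_mem_seedVectors hz' (by rw [← hg i, ← hg j, hij])
  obtain ⟨g', hg'⟩ := (Finite.injective_iff_surjective.1 hginj).hasRightInverse
  intro i j hij hzij
  refine hij ?_
  rw [← hg' i, ← hg' j, hg, hg] at hzij
  rw [← hg' i, ← hg' j, injective_of_mem_seedVectors hz' hzij]

lemma discreteMeasure_comp_equiv (m' : Fin N' → ℝ) (z' : Fin N' → E3) (σ : Fin N ≃ Fin N') :
    discreteMeasure (fun i => m' (σ i)) (fun i => z' (σ i)) = discreteMeasure m' z' :=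
  Equiv.sum_comp σ fun j => ENNReal.ofReal (m' j) • Measure.dirac (z' j)

/-- A competitor may have its own number of seeds, masses and labelling. The weak equation gives the
ODE for these, then identifies the initial atoms and masses, and a fixed permutation transfers
everything to the given labelling. -/
lemma IsC1DiscreteGeostrophicSolution.exists_isSeedFlow (hΩ : IsUnitDomain Ω R)
    (hm : IsMassVector m) {T : ℝ} (hT : 0 < T) {z₀ : Fin N → E3} (hz₀ : z₀ ∈ seedVectors N)
    {β : ℝ → Measure E3} (hβ : IsC1DiscreteGeostrophicSolution Ω T (discreteMeasure m z₀) β) :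
    ∃ y, IsSeedFlow Ω m T y ∧ y 0 = z₀ ∧ ∀ t ∈ Icc 0 T, β t = discreteMeasure m (y t) := by
  obtain ⟨hsol, N', m', z', hm', hz', hβz⟩ := hβ
  rw [contDiffOn_one_iff_derivWithin (uniqueDiffOn_Icc hT)] at hz'
  set v := derivWithin z' (Icc 0 T) with hv
  have hd : ∀ t ∈ Icc 0 T, HasDerivWithinAt z' (v t) (Icc 0 T) t := fun t ht =>
    (hz'.1 t ht).hasDerivWithinAt
  have hseed : ∀ t ∈ Icc 0 T, z' t ∈ seedVectors N' := fun t ht =>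
    mem_seedVectors_of_mem_discreteMeasures ((hβz t ht).1 ▸ (hβz t ht).2)
  have h0 : (0 : ℝ) ∈ Icc 0 T := ⟨le_rfl, hT.le⟩
  have hvel := eq_velocity_of_isGeostrophicSolution hΩ hm' hT hd hz'.2 hseed
    (fun t ht => (hβz t ht).1) hsol
  -- The initial measure enters the definition only through the weak equation. With the velocity
  -- defect zero, a test function whose time factor is `1` at `0` reads off the initial data.
  have hinit : ∀ Ψ : E3 → ℝ, ContDiff ℝ ∞ Ψ → HasCompactSupport Ψ →
      ∑ i, m i * Ψ (z₀ i) = ∑ j, m' j * Ψ (z' 0 j) := by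
    intro Ψ hΨ hΨc
    let χ : ContDiffBump (0 : ℝ) := ⟨1, 2, one_pos, one_lt_two⟩
    have hχ0 : χ 0 = 1 := χ.one_of_mem_closedBall (Metric.mem_closedBall_self χ.rIn_pos.le)
    have h1 := hΩ.integral_transportDeriv_sub hm' hT.le hd hz'.2 hseed
      (fun t ht => (hβz t ht).1) hsol (contDiff_prodTest χ.contDiff hΨ)
      (hasCompactSupport_prodTest χ.hasCompactSupport hΨc)
    have h2 : ∫ t in (0 : ℝ)..T,
        transportDeriv m' (prodTest χ Ψ) t (z' t) (velocity Ω m' (z' t) - v t) 0 = 0 := by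
      refine (intervalIntegral.integral_congr fun t ht => ?_).trans
        intervalIntegral.integral_zero
      rw [uIcc_of_le hT.le] at ht
      rw [← hvel t ht, sub_self]
      refine Finset.sum_eq_zero fun i _ => ?_
      rw [Pi.zero_apply, Prod.mk_zero_zero, map_zero, mul_zero]
    rw [h2, integral_discreteMeasure fun i => (hm.1 i).le] at h1
    simp only [prodTest, hχ0, one_mul, smul_eq_mul] at h1
    linarith
  obtain ⟨σ, hσ⟩ := exists_equiv_of_forall_test_eq hm hm' hz₀ (hseed 0 h0) hinit
  have hmσ : (fun i => m' (σ i)) = m := funext fun i => (hσ i).2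
  have hβy : ∀ t ∈ Icc 0 T, β t = discreteMeasure m fun i => z' t (σ i) := fun t ht => by
    rw [(hβz t ht).1, ← hmσ, discreteMeasure_comp_equiv]
  have hseedy : ∀ t ∈ Icc 0 T, (fun i => z' t (σ i)) ∈ seedVectors N := fun t ht i j hij =>
    hseed t ht _ _ (σ.injective.ne hij)
  have hdy : ∀ t ∈ Icc 0 T, HasDerivWithinAt (fun t i => z' t (σ i)) (fun i => v t (σ i))
      (Icc 0 T) t := fun t ht =>
    hasDerivWithinAt_pi.2 fun i => hasDerivWithinAt_pi.1 (hd t ht) (σ i)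
  have hvy : ContinuousOn (fun t i => v t (σ i)) (Icc 0 T) :=
    continuousOn_pi.2 fun i => continuousOn_pi.1 hz'.2 (σ i)
  -- Applying the identification again to the relabelled paths avoids checking that `velocity`,
  -- built on chosen weights, commutes with permutations.
  have hvely := eq_velocity_of_isGeostrophicSolution hΩ hm hT hdy hvy hseedy hβy hsol
  refine ⟨fun t i => z' t (σ i), fun t ht => ⟨hseedy t ht, ?_⟩, funext fun i => (hσ i).1, hβy⟩
  rw [← hvely t ht]
  exact hdy t ht

lemma IsSeedFlow.isC1DiscreteGeostrophicSolution (hΩ : IsUnitDomain Ω R)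
    (hm : IsMassVector m) {T : ℝ} (hT : 0 < T) {z : ℝ → Fin N → E3} (hz : IsSeedFlow Ω m T z) :
    IsC1DiscreteGeostrophicSolution Ω T (discreteMeasure m (z 0))
      fun t => discreteMeasure m (z t) := by
  have hm0 : ∀ i, 0 ≤ m i := fun i => (hm.1 i).le
  refine ⟨⟨isContinuousCurve_discreteMeasure hm hz.continuousOn, fun φ hφ _ => ?_⟩, N, m, z, hm,
    hz.contDiffOn hΩ hm hT, fun t ht => ⟨rfl, m, z t, hm, (hz t ht).1, rfl⟩⟩
  have hseed : ∀ t ∈ Icc 0 T, z t ∈ seedVectors N := fun t ht => (hz t ht).1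
  rw [hΩ.weak_formulation hm hT.le hz.continuousOn hseed (fun _ _ => rfl) hφ,
    integral_transportDeriv m hφ hT.le (fun t ht => (hz t ht).2)
      (hΩ.continuousOn_velocity_comp hm hz.continuousOn hseed),
    integral_discreteMeasure hm0, integral_discreteMeasure hm0]
  rfl

lemma exists_isUnitDomain (hΩ_open : IsOpen Ω) (hΩ_bdd : Bornology.IsBounded Ω)
    (hΩ_convex : Convex ℝ Ω) (hΩ_vol : volume Ω = 1) : ∃ R, IsUnitDomain Ω R := by
  obtain ⟨R, hR, h⟩ := hΩ_bdd.exists_pos_norm_le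
  exact ⟨R, hΩ_open, hΩ_convex, hΩ_vol, hR, h⟩

end Identification

end SemiGeostrophic

open SemiGeostrophic in
theorem theorem3p5 (Ω : Set E3) (hΩ_open : IsOpen Ω) (hΩ_bdd : Bornology.IsBounded Ω)
    (hΩ_convex : Convex ℝ Ω) (hΩ_vol : volume Ω = 1)
    (N : ℕ) (hN : 2 ≤ N) (T : ℝ) (hT : 0 < T)
    (m : Fin N → ℝ) (hm : IsMassVector m)
    (z₀ : Fin N → E3) (hz₀ : z₀ ∈ seedVectors N) (hwp : IsWellPrepared z₀) :
    ∃ α : ℝ → Measure E3,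
      IsC1DiscreteGeostrophicSolution Ω T (discreteMeasure m z₀) α ∧
      (∀ β : ℝ → Measure E3, IsC1DiscreteGeostrophicSolution Ω T (discreteMeasure m z₀) β →
        ∀ t ∈ Icc 0 T, β t = α t) ∧
      IsEnergyConserving Ω T α ∧
      ∃ z : ℝ → Fin N → E3, ContDiffOn ℝ 1 z (Icc 0 T) ∧ z 0 = z₀ ∧
        ∀ t ∈ Icc 0 T, z t ∈ seedVectors N ∧ α t = discreteMeasure m (z t) := by
  obtain ⟨R, hΩ⟩ := exists_isUnitDomain hΩ_open hΩ_bdd hΩ_convex hΩ_vol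
  obtain ⟨z, hz, rfl⟩ := hΩ.exists_isSeedFlow hm hwp hT.le
  refine ⟨fun t => discreteMeasure m (z t), hz.isC1DiscreteGeostrophicSolution hΩ hm hT,
    fun β hβ t ht => ?_, fun s hs t ht => ?_, z, hz.contDiffOn hΩ hm hT, rfl,
    fun t ht => ⟨(hz t ht).1, rfl⟩⟩
  · obtain ⟨y, hy, hy0, hβy⟩ := hβ.exists_isSeedFlow hΩ hm hT hz₀
    rw [hβy t ht, hy.eqOn hΩ hm hz hy0 (hy0 ▸ hwp) ht]
  · simp only
    rw [hz.geostrophicEnergy_eq hΩ hm hs, hz.geostrophicEnergy_eq hΩ hm ht]
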